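/- **Setting.** Let $q_0>0$, let $\mathbf q_\pm\in\mathbb C^2$ with $\|\mathbf q_\pm\|=q_0$, and let $\mathbf q(x,t)=(q_1,q_2)^T\in\mathbb C^2$ for $x,t\in\mathbb R$. For $z\in\mathbb C\setminus\{0\}$ put $k=\frac12(z-q_0^2/z)$, $\lambda=\frac12(z+q_0^2/z)$, $\mathbf\Lambda_1=\operatorname{diag}(-\lambda,k,\lambda)$, $$\mathbf Q(x,t)=\begin{pmatrix}0&\mathbf q^\dagger\\-\mathbf q&\mathbf 0_{2\times2}\end{pmatrix},\quad \mathbf Q_\pm=\begin{pmatrix}0&\mathbf q_\pm^\dagger\\-\mathbf q_\pm&\mathbf 0_{2\times2}\end{pmatrix},\quad \mathbf Y_\pm(z)=\begin{pmatrix}1&0&-\mathrm iq_0/z\\-\frac{\mathrm i}{z}\mathbf q_\pm&\mathbf q_\pm^\perp/q_0&\mathbf q_\pm/q_0\end{pmatrix},$$ where $(v_1,v_2)^\perp=(\overline{v_2},-\overline{v_1})^T$; $\mathbf A=-\mathrm ik\,\mathbf J+\mathbf Q$ with $\mathbf J=\operatorname{diag}(1,-1,-1)$, $\mathbf A_\pm=-\mathrm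 ik\,\mathbf J+\mathbf Q_\pm$, so that $\Delta\mathbf A_\pm=\mathbf A-\mathbf A_\pm=\mathbf Q-\mathbf Q_\pm$. The modified Jost eigenfunctions $\nu_\pm(x,t,z)$ are the solutions of $$\nu_\pm(x,t,z)=\mathbf Y_\pm(z)+\int_{\pm\infty}^x \mathbf Y_\pm(z)\,e^{\mathrm i(x-r)\mathbf\Lambda_1(z)}\,\mathbf Y_\pm^{-1}(z)\,\Delta\mathbf A_\pm(r,t)\,\nu_\pm(r,t,z)\,e^{-\mathrm i(x-r)\mathbf\Lambda_1(z)}\,dr .$$ This equation decouples into one equation for each column $\nu_{\pm,j}$, $j=1,2,3$. By the column $\nu_{\pm,j}(\cdot,t,z)$ at $z\notin\{0,\pm\mathrm iq_0\}$ we mean a continuous function of $x\in\mathbb R$ that tends to the $j$-th column of $\mathbf Y_\pm(z)$ as $x\to\pm\infty$ and satisfies the $j$-th column equation for all $x$, with absolutely convergent integral. Let $$\mathbb U_1=\{\operatorname{Im}z>0,\ |z|>q_0\},\quad \mathbb U_2=\{\operatorname{Im}z<0,\ |z|>q_0\},\quad \mathbb U_3=\{\operatorname{Im}z<0,\ |z|<q_0\},\quad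 \mathbb U_4=\{\operatorname{Im}z>0,\ |z|<q_0\}.$$ **Theorem.** Fix $t\in\mathbb R$. (a) Suppose that $\mathbf q(\cdot,t)-\mathbf q_-\in L^1(-\infty,a)$ for every $a\in\mathbb R$. Then the columns of $\nu_-$ extend analytically to the following regions: $\nu_{-,1}$ to $\mathbb U_1$; $\nu_{-,2}$ to $\{\operatorname{Im}z<0\}$; $\nu_{-,3}$ to $\mathbb U_4$. (b) Suppose that $\mathbf q(\cdot,t)-\mathbf q_+\in L^1(a,\infty)$ for every $a\in\mathbb R$. Then the columns of $\nu_+$ extend analytically to the following regions: $\nu_{+,1}$ to $\mathbb U_2$; $\nu_{+,2}$ to $\{\operatorname{Im}z>0\}$; $\nu_{+,3}$ to $\mathbb U_3$. Here "the column extends analytically to the region $D$" means: for every $z\in\overline D\setminus\{0,\pm\mathrm iq_0\}$ the column exists and is unique; and for each $x\in\mathbb R$ its value at $x$, as a function of $z$, is continuous on $\overline D\setminus\{0,\pm\mathrm iq_0\}$ and coincides there with a function that is analytic on all of $D$ (including the point $\mp\mathrm iq_0\in D$ for $\nu_{\mp,2}$). -/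

import Mathlib

namespace LPD

noncomputable section

/-- Values of the two-component field `q = (q₁, q₂)ᵀ`, with the Hermitian norm. -/
abbrev Vec2 := EuclideanSpace ℂ (Fin 2)

/-- `v^⊥ = (v₂, -v₁)^†`. -/
def perp (v : Vec2) : Vec2 := !₂[star (v 1), -star (v 0)]

/-- The spectral parameter `k = (z - q₀² / z) / 2` in terms of the uniformization variable. -/
def kVar (q0 : ℝ) (z : ℂ) : ℂ := (z - (q0 : ℂ) ^ 2 / z) / 2

/-- `lambda = (z + q₀² / z) / 2` in terms of the uniformization variable. -/
def lamVar (q0 : ℝ) (z : ℂ) : ℂ := (z + (q0 : ℂ) ^ 2 / z) / 2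

/-- `J = diag(1, -1, -1)`. -/
def J : Matrix (Fin 3) (Fin 3) ℂ :=
  !![1, 0, 0;
     0, -1, 0;
     0, 0, -1]

/-- The potential matrix `Q`, with blocks `0`, `q^†`, `-q`, `0`. -/
def Q (q : Vec2) : Matrix (Fin 3) (Fin 3) ℂ :=
  !![0, star (q 0), star (q 1);
     -q 0, 0, 0;
     -q 1, 0, 0]

/-- The spatial Lax matrix `A = -i k J + Q`, as a function of `k` and the value of `q`. -/
def laxA (k : ℂ) (q : Vec2) : Matrix (Fin 3) (Fin 3) ℂ := -(Complex.I * k) • J + Q q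

/-- The eigenvector matrix `Y_±(z)`; the argument `qb` is the boundary value `q_±`. -/
def Y (q0 : ℝ) (qb : Vec2) (z : ℂ) : Matrix (Fin 3) (Fin 3) ℂ :=
  !![1, 0, -(Complex.I * q0 / z);
     -(Complex.I / z) * qb 0, perp qb 0 / q0, qb 0 / q0;
     -(Complex.I / z) * qb 1, perp qb 1 / q0, qb 1 / q0]

/-- The diagonal of `Λ₁ = diag(-lambda, k, lambda)`. -/
def Lam (q0 : ℝ) (z : ℂ) : Fin 3 → ℂ := ![-lamVar q0 z, kVar q0 z, lamVar q0 z]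

/-- `exp(i s Λ₁(z))`. -/
def expLam (q0 : ℝ) (z : ℂ) (s : ℝ) : Matrix (Fin 3) (Fin 3) ℂ :=
  Matrix.diagonal fun l => Complex.exp (Complex.I * s * Lam q0 z l)

/-- `ΔA_± = A - A_±` at a point where the field has the value `q`. -/
def deltaA (q0 : ℝ) (qb : Vec2) (z : ℂ) (q : Vec2) : Matrix (Fin 3) (Fin 3) ℂ :=
  laxA (kVar q0 z) q - laxA (kVar q0 z) qb

/-- The integrand of the matrix Volterra equation,
`Y_± exp(i (x - r) Λ₁) Y_±⁻¹ ΔA_±(r) N(r) exp(-i (x - r) Λ₁)`,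
for a field `u` on the line and a value `N = N(r)` of the unknown. -/
def matrixIntegrand (q0 : ℝ) (qb : Vec2) (u : ℝ → Vec2) (z : ℂ) (x r : ℝ)
    (N : Matrix (Fin 3) (Fin 3) ℂ) : Matrix (Fin 3) (Fin 3) ℂ :=
  Y q0 qb z * expLam q0 z (x - r) * ((Y q0 qb z)⁻¹ * deltaA q0 qb z (u r) * N) *
    expLam q0 z (-(x - r))

/-- The `j`-th column of the integrand; it involves only the `j`-th column `v` of the unknown. -/
def colIntegrand (q0 : ℝ) (qb : Vec2) (u : ℝ → Vec2) (z : ℂ) (j : Fin 3) (x r : ℝ)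
    (v : Fin 3 → ℂ) : Fin 3 → ℂ :=
  Complex.exp (-(Complex.I * (x - r) * Lam q0 z j)) •
    (Y q0 qb z * expLam q0 z (x - r) * (Y q0 qb z)⁻¹ * deltaA q0 qb z (u r)).mulVec v

theorem matrixIntegrand_col (q0 : ℝ) (qb : Vec2) (u : ℝ → Vec2) (z : ℂ) (j : Fin 3) (x r : ℝ)
    (N : Matrix (Fin 3) (Fin 3) ℂ) :
    (matrixIntegrand q0 qb u z x r N).col j = colIntegrand q0 qb u z j x r (N.col j) := by
  have h : matrixIntegrand q0 qb u z x r N =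
      (Y q0 qb z * expLam q0 z (x - r) * (Y q0 qb z)⁻¹ * deltaA q0 qb z (u r) * N) *
        expLam q0 z (-(x - r)) := by
    simp only [matrixIntegrand, Matrix.mul_assoc]
  rw [h]
  ext i
  simp only [Matrix.col_apply, colIntegrand, expLam, Matrix.mul_diagonal, Pi.smul_apply,
    smul_eq_mul]
  rw [mul_comm]
  congr 1
  congr 1
  push_cast
  ring

/-- `f` is the `j`-th column of the modified Jost eigenfunction `ν_-` at the spectral
parameter `z`: it tends to the `j`-th column of `Y_-` as `x → -∞` and solves the `j`-th column
of the Volterra equation with base point `-∞`, the integral being absolutely convergent. -/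
structure IsJostColMinus (q0 : ℝ) (qb : Vec2) (u : ℝ → Vec2) (j : Fin 3) (z : ℂ)
    (f : ℝ → Fin 3 → ℂ) : Prop where
  cont : Continuous f
  tendsto : Filter.Tendsto f Filter.atBot (nhds ((Y q0 qb z).col j))
  integrable : ∀ x : ℝ, MeasureTheory.IntegrableOn
    (fun r => colIntegrand q0 qb u z j x r (f r)) (Set.Iic x)
  volterra : ∀ x : ℝ, f x = (Y q0 qb z).col j +
    ∫ r in Set.Iic x, colIntegrand q0 qb u z j x r (f r)

/-- `f` is the `j`-th column of the modified Jost eigenfunction `ν_+` at the spectral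
parameter `z`. The minus sign turns the integral over `(x, ∞)` into the integral from `+∞`
to `x`. -/
structure IsJostColPlus (q0 : ℝ) (qb : Vec2) (u : ℝ → Vec2) (j : Fin 3) (z : ℂ)
    (f : ℝ → Fin 3 → ℂ) : Prop where
  cont : Continuous f
  tendsto : Filter.Tendsto f Filter.atTop (nhds ((Y q0 qb z).col j))
  integrable : ∀ x : ℝ, MeasureTheory.IntegrableOn
    (fun r => colIntegrand q0 qb u z j x r (f r)) (Set.Ioi x)
  volterra : ∀ x : ℝ, f x = (Y q0 qb z).col j -
    ∫ r in Set.Ioi x, colIntegrand q0 qb u z j x r (f r)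

/-- The points where `Y_±` is undefined (`0`) or singular (`± i q₀`). -/
def excPts (q0 : ℝ) : Set ℂ := {0, Complex.I * q0, -(Complex.I * q0)}

/-- `IsCol z f` says that `f` is a certain column of a modified eigenfunction at `z`.
For every `z` in the closure of `D`, exceptional points apart, there is exactly one such column;
for each `x` its value at `x` is continuous in `z` there (in particular up to the boundary), and
it extends to a function of `z` that is analytic on all of `D`. -/
def ExtendsAnalytically (q0 : ℝ) (IsCol : ℂ → (ℝ → Fin 3 → ℂ) → Prop) (D : Set ℂ) : Prop :=
  ∃ ν : ℝ → ℂ → Fin 3 → ℂ,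
    (∀ z ∈ closure D \ excPts q0, ∀ f : ℝ → Fin 3 → ℂ, IsCol z f ↔ f = fun x => ν x z) ∧
    ∀ x : ℝ, AnalyticOnNhd ℂ (ν x) D ∧ ContinuousOn (ν x) (closure D \ excPts q0)

def U1 (q0 : ℝ) : Set ℂ := {z | 0 < z.im ∧ q0 < ‖z‖}
def U2 (q0 : ℝ) : Set ℂ := {z | z.im < 0 ∧ q0 < ‖z‖}
def U3 (q0 : ℝ) : Set ℂ := {z | z.im < 0 ∧ ‖z‖ < q0}
def U4 (q0 : ℝ) : Set ℂ := {z | 0 < z.im ∧ ‖z‖ < q0}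

end

end LPD

/-! Each column equation is a Volterra equation `f = g + ∫ K (x - r) V r (f r) dr` over `(-∞, x)`,
after the reflection `x ↦ -x` in the case of `ν_+`. The kernel `K` depends on `z`, and the potential
`V` is integrable near `-∞` and independent of `z`. If `‖K s‖ ≤ C` for `s ≥ 0`, the `n`-th term of
the Neumann series is at most `G (C M)^n / n!`, where `G` bounds the inhomogeneity and `M` is the
integral of `‖V‖` (`factorial_mul_simplexVolume_le`, `norm_neumannTerm_le`). Bounds on `C` and `G`
that are locally uniform in `z` make the convergence locally uniform. Continuity and analyticity
then pass from the terms to the sum, and the same estimate forces uniqueness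
(`exists_volterraSolution_family`).

It remains to control the kernel, which is `exp (-i s Λ_j)` times `exp (s A_±)`. The eigenvector
matrix is singular at `±i q₀`, so the exponential is written without it. On the span of `(0, q_±^⊥)`
it is `exp (i s k)`; on the complement `A_±² = -lambda²`, which gives `cos (lambda s) + A_± sin
(lambda s) / lambda` (`propagator_mul_Y`). This is analytic for all `z ≠ 0`.

The signs of `Im k` and `Im lambda` bound the first two pieces in the stated regions. The piece with
`sin (lambda s) / lambda` is bounded where `lambda ≠ 0`, and also where the exponential factor
decays strictly (`exists_bound_sinc`). The second alternative holds for the second column off the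
real axis, which is why that column extends across `∓i q₀`. -/

open MeasureTheory Set Filter Topology
open scoped ENNReal

/-! ### Iterated integrals over ordered simplices and the factorial bound. -/

/-- The iterated integrals `∫_{r₁ < ⋯ < rₙ < x} dμ(r₁) ⋯ dμ(rₙ)`. -/
noncomputable def simplexVolume (μ : Measure ℝ) : ℕ → ℝ → ℝ≥0∞
  | 0 => fun _ => 1
  | n + 1 => fun x => ∫⁻ r in Iio x, simplexVolume μ n r ∂μ

theorem simplexVolume_succ (μ : Measure ℝ) (n : ℕ) (x : ℝ) :
    simplexVolume μ (n + 1) x = ∫⁻ r in Iio x, simplexVolume μ n r ∂μ := rfl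

theorem simplexVolume_mono (μ : Measure ℝ) (n : ℕ) : Monotone (simplexVolume μ n) := by
  cases n with
  | zero => exact monotone_const
  | succ n =>
    intro x y h
    exact lintegral_mono_set (Iio_subset_Iio h)

theorem measurable_simplexVolume (μ : Measure ℝ) (n : ℕ) : Measurable (simplexVolume μ n) :=
  (simplexVolume_mono μ n).measurable

/-- A new point `s` is placed either below or above the largest point `r` of an ordered chain. The
two cases give the two summands in the inductive step. The diagonal `r = s` is discarded, so atoms
of `μ` do no harm and only an inequality results. -/
theorem succ_mul_simplexVolume_succ_le (μ : Measure ℝ) [SFinite μ] (n : ℕ) (x : ℝ) :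
    (n + 1 : ℝ≥0∞) * simplexVolume μ (n + 1) x ≤ μ (Iio x) * simplexVolume μ n x := by
  induction n generalizing x with
  | zero => simp [simplexVolume]
  | succ n ih =>
    have hJ := measurable_simplexVolume μ n
    have hm1 : Measurable fun p : ℝ × ℝ => (Ioi p.1).indicator (simplexVolume μ n) p.2 := by
      have : (fun p : ℝ × ℝ => (Ioi p.1).indicator (simplexVolume μ n) p.2) =
          {p : ℝ × ℝ | p.1 < p.2}.indicator (fun p => simplexVolume μ n p.2) := by
        ext p; simp [indicator]
      rw [this]
      exact (hJ.comp measurable_snd).indicator (measurableSet_lt measurable_fst measurable_snd)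
    have hm1' : ∀ s, Measurable ((Ioi s).indicator (simplexVolume μ n)) := fun s =>
      hJ.indicator measurableSet_Ioi
    -- The induction hypothesis under the integral over `r` yields `μ (Iio r)`, which is the mass of
    -- the points `s < r`; Tonelli exchanges the two variables.
    have first : ((n + 1 : ℕ) : ℝ≥0∞) * simplexVolume μ (n + 2) x ≤
        ∫⁻ s in Iio x, ∫⁻ r in Iio x, (Ioi s).indicator (simplexVolume μ n) r ∂μ ∂μ := by
      rw [lintegral_lintegral_swap hm1.aemeasurable, simplexVolume_succ,
        ← lintegral_const_mul _ (measurable_simplexVolume μ (n + 1))]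
      refine setLIntegral_mono' measurableSet_Iio fun r hr => ?_
      have : ∀ s, (Ioi s).indicator (simplexVolume μ n) r =
          (Iio r).indicator (fun _ => simplexVolume μ n r) s := fun s => by simp [indicator]
      simp_rw [this]
      rw [lintegral_indicator_const measurableSet_Iio, Measure.restrict_apply measurableSet_Iio,
        Iio_inter_Iio, inf_eq_left.2 (le_of_lt hr), mul_comm (simplexVolume μ n r)]
      exact_mod_cast ih r
    have second : simplexVolume μ (n + 2) x =
        ∫⁻ s in Iio x, ∫⁻ r in Iio x, (Iio s).indicator (simplexVolume μ n) r ∂μ ∂μ := by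
      rw [simplexVolume_succ]
      refine setLIntegral_congr_fun measurableSet_Iio fun s hs => ?_
      rw [lintegral_indicator measurableSet_Iio, Measure.restrict_restrict measurableSet_Iio,
        Iio_inter_Iio, inf_eq_left.2 (le_of_lt hs), simplexVolume_succ]
    calc ((n + 1 : ℕ) + 1 : ℝ≥0∞) * simplexVolume μ (n + 2) x
        = ((n + 1 : ℕ) : ℝ≥0∞) * simplexVolume μ (n + 2) x + simplexVolume μ (n + 2) x := by
          rw [add_mul, one_mul]
      _ ≤ (∫⁻ s in Iio x, ∫⁻ r in Iio x, (Ioi s).indicator (simplexVolume μ n) r ∂μ ∂μ) +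
          ∫⁻ s in Iio x, ∫⁻ r in Iio x, (Iio s).indicator (simplexVolume μ n) r ∂μ ∂μ :=
          add_le_add first second.le
      _ = ∫⁻ s in Iio x, ((∫⁻ r in Iio x, (Ioi s).indicator (simplexVolume μ n) r ∂μ) +
          ∫⁻ r in Iio x, (Iio s).indicator (simplexVolume μ n) r ∂μ) ∂μ :=
          (lintegral_add_left hm1.lintegral_prod_right' _).symm
      _ ≤ ∫⁻ _ in Iio x, simplexVolume μ (n + 1) x ∂μ := by
          refine lintegral_mono fun s => ?_
          rw [← lintegral_add_left (hm1' s), simplexVolume_succ]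
          refine lintegral_mono fun r => ?_
          rcases lt_trichotomy s r with h | h | h
          · simp [indicator, h, h.not_gt]
          · simp [indicator, h]
          · simp [indicator, h, h.not_gt]
      _ = μ (Iio x) * simplexVolume μ (n + 1) x := by
          rw [setLIntegral_const, mul_comm]

theorem factorial_mul_simplexVolume_le (μ : Measure ℝ) [SFinite μ] (n : ℕ) (x : ℝ) :
    (n.factorial : ℝ≥0∞) * simplexVolume μ n x ≤ μ (Iio x) ^ n := by
  induction n with
  | zero => simp [simplexVolume]
  | succ n ih =>
    calc ((n + 1).factorial : ℝ≥0∞) * simplexVolume μ (n + 1) x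
        = n.factorial * ((n + 1 : ℝ≥0∞) * simplexVolume μ (n + 1) x) := by
          rw [Nat.factorial_succ]; push_cast; ring
      _ ≤ n.factorial * (μ (Iio x) * simplexVolume μ n x) :=
          mul_le_mul' le_rfl (succ_mul_simplexVolume_succ_le μ n x)
      _ = μ (Iio x) * (n.factorial * simplexVolume μ n x) := by ring
      _ ≤ μ (Iio x) * μ (Iio x) ^ n := by gcongr
      _ = μ (Iio x) ^ (n + 1) := by ring

theorem toReal_simplexVolume_le (μ : Measure ℝ) [SFinite μ] (n : ℕ) {x a : ℝ} (hxa : x ≤ a)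
    (ha : μ (Iio a) ≠ ∞) :
    simplexVolume μ n x ≠ ∞ ∧
      (simplexVolume μ n x).toReal ≤ (μ (Iio a)).toReal ^ n / n.factorial := by
  have h : (n.factorial : ℝ≥0∞) * simplexVolume μ n x ≤ μ (Iio a) ^ n :=
    (factorial_mul_simplexVolume_le μ n x).trans (by gcongr)
  have htop : μ (Iio a) ^ n ≠ ∞ := ENNReal.pow_ne_top ha
  have hfin : simplexVolume μ n x ≠ ∞ := by
    intro h'
    rw [h', ENNReal.mul_top (by exact_mod_cast n.factorial_ne_zero)] at h
    exact htop (top_le_iff.1 h)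
  refine ⟨hfin, ?_⟩
  rw [le_div_iff₀ (by positivity)]
  have := ENNReal.toReal_mono htop h
  simpa [mul_comm] using this

/-! ### Holomorphy of integrals depending on a parameter. -/

section ParametricIntegral

variable {α E : Type*} [MeasurableSpace α] {μ : Measure α} [NormedAddCommGroup E]
  [NormedSpace ℂ E]

/-- A dominated integral of holomorphic functions is holomorphic. -/
theorem differentiableOn_integral_of_dominated {F : ℂ → α → E} {D : Set ℂ} {b : α → ℝ}
    (hD : IsOpen D) (hmeas : ∀ z ∈ D, AEStronglyMeasurable (F z) μ) (hb : Integrable b μ)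
    (hbound : ∀ᵐ a ∂μ, ∀ z ∈ D, ‖F z a‖ ≤ b a)
    (hdiff : ∀ᵐ a ∂μ, DifferentiableOn ℂ (fun z => F z a) D) :
    DifferentiableOn ℂ (fun z => ∫ a, F z a ∂μ) D := by
  intro z₀ hz₀
  obtain ⟨ε, hε, hball⟩ := Metric.isOpen_iff.1 hD z₀ hz₀
  have hδ : 0 < ε / 2 := by positivity
  have hderiv_at : ∀ᵐ a ∂μ, ∀ z ∈ D, HasDerivAt (fun z => F z a) (deriv (fun z => F z a) z) z := by
    filter_upwards [hdiff] with a ha z hz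
    exact (ha.differentiableAt (hD.mem_nhds hz)).hasDerivAt
  -- The derivative is measurable in `a` as a limit of difference quotients along the points `z₀ + ε
  -- / (2 (n + 1))`, which stay in `D`.
  have hF'meas : AEStronglyMeasurable (fun a => deriv (fun z => F z a) z₀) μ := by
    have hseq : Tendsto (fun n : ℕ => z₀ + ((ε / 2 / (n + 1) : ℝ) : ℂ)) atTop (𝓝[≠] z₀) := by
      refine tendsto_nhdsWithin_iff.2 ⟨?_, ?_⟩
      · have h0 : Tendsto (fun n : ℕ => (ε / 2 / (n + 1) : ℝ)) atTop (𝓝 0) := by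
          simpa [div_eq_mul_inv] using
            (tendsto_one_div_add_atTop_nhds_zero_nat (𝕜 := ℝ)).const_mul (ε / 2)
        have := (Complex.continuous_ofReal.tendsto 0).comp h0
        simpa using this.const_add z₀
      · refine Eventually.of_forall fun n => ?_
        have : (0 : ℝ) < ε / 2 / (n + 1) := by positivity
        simp only [mem_compl_iff, mem_singleton_iff, add_eq_left, Complex.ofReal_eq_zero]
        exact this.ne'
    refine aestronglyMeasurable_of_tendsto_ae atTop
      (f := fun (n : ℕ) a => slope (fun z => F z a) z₀ (z₀ + ((ε / 2 / (n + 1) : ℝ) : ℂ))) ?_ ?_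
    · intro n
      have hmem : z₀ + ((ε / 2 / (n + 1) : ℝ) : ℂ) ∈ D := by
        apply hball
        rw [Metric.mem_ball, dist_eq_norm, add_sub_cancel_left, Complex.norm_real,
          Real.norm_of_nonneg (by positivity)]
        calc ε / 2 / (n + 1) ≤ ε / 2 := div_le_self hδ.le (by linarith [n.cast_nonneg (α := ℝ)])
          _ < ε := by linarith
      simp only [slope_def_module]
      exact ((hmeas _ hmem).sub (hmeas _ hz₀)).const_smul _
    · filter_upwards [hderiv_at] with a ha
      exact (hasDerivAt_iff_tendsto_slope.1 (ha z₀ hz₀)).comp hseq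
  -- Circles of radius `ε / 4` about points of the half-size ball remain in `D`, so Cauchy's
  -- estimate dominates the derivative by `b a / (ε / 4)`.
  have hsub : ∀ z ∈ Metric.ball z₀ (ε / 2), Metric.closedBall z (ε / 4) ⊆ D := by
    intro z hz w hw
    apply hball
    rw [Metric.mem_ball] at hz ⊢
    rw [Metric.mem_closedBall] at hw
    linarith [dist_triangle w z z₀]
  refine (hasDerivAt_integral_of_dominated_loc_of_deriv_le (μ := μ) (F := F)
    (F' := fun z a => deriv (fun z => F z a) z) (bound := fun a => b a / (ε / 4))
    (Metric.ball_mem_nhds z₀ hδ) ?_ ?_ hF'meas ?_ (hb.div_const _) ?_).2.differentiableAt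
    |>.differentiableWithinAt
  · exact (hD.eventually_mem hz₀).mono fun z hz => hmeas z hz
  · refine hb.mono' (hmeas _ hz₀) ?_
    filter_upwards [hbound] with a ha using ha _ hz₀
  · filter_upwards [hdiff, hbound] with a ha hba z hz
    refine Complex.norm_deriv_le_of_forall_mem_sphere_norm_le (by positivity) ?_ fun w hw => ?_
    · refine DifferentiableOn.diffContOnCl (ha.mono ?_)
      rw [closure_ball _ (by positivity)]
      exact hsub z hz
    · exact hba w (hsub z hz (Metric.sphere_subset_closedBall hw))
  · filter_upwards [hderiv_at] with a ha z hz
    exact ha z (hsub z hz (Metric.mem_closedBall_self (by positivity)))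

end ParametricIntegral

/-! ### The Volterra operator: bounds, uniqueness, continuity and holomorphy. -/

section Volterra

variable {E : Type*} [NormedAddCommGroup E] [NormedSpace ℂ E]

/-- The measure `‖V r‖ dr`. -/
noncomputable def normMeasure (V : ℝ → E →L[ℂ] E) : Measure ℝ :=
  volume.withDensity fun r => ‖V r‖ₑ

theorem aestronglyMeasurable_of_integrableOn_Iio {V : ℝ → E →L[ℂ] E}
    (hV : ∀ a, IntegrableOn V (Iio a)) : AEStronglyMeasurable V := by
  have h := (aestronglyMeasurable_iUnion_iff (μ := volume) (f := V)
    (s := fun n : ℕ => Iio (n : ℝ))).2 fun n => (hV n).1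
  have hU : ⋃ n : ℕ, Iio (n : ℝ) = univ :=
    eq_univ_of_forall fun x => mem_iUnion.2 (exists_nat_gt x)
  rwa [hU, Measure.restrict_univ] at h

theorem lintegral_normMeasure {V : ℝ → E →L[ℂ] E} (hV : ∀ a, IntegrableOn V (Iio a))
    {f : ℝ → ℝ≥0∞} (hf : Measurable f) (x : ℝ) :
    ∫⁻ r in Iio x, f r ∂normMeasure V = ∫⁻ r in Iio x, ‖V r‖ₑ * f r := by
  have hm := (aestronglyMeasurable_of_integrableOn_Iio hV).enorm
  rw [normMeasure, restrict_withDensity measurableSet_Iio,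
    lintegral_withDensity_eq_lintegral_mul₀ hm.restrict hf.aemeasurable]
  rfl

theorem normMeasure_Iio (V : ℝ → E →L[ℂ] E) (x : ℝ) :
    normMeasure V (Iio x) = ∫⁻ r in Iio x, ‖V r‖ₑ :=
  withDensity_apply _ measurableSet_Iio

theorem normMeasure_Iio_ne_top {V : ℝ → E →L[ℂ] E} (hV : ∀ a, IntegrableOn V (Iio a)) (x : ℝ) :
    normMeasure V (Iio x) ≠ ∞ := by
  rw [normMeasure_Iio]
  exact (hV x).2.ne

instance (V : ℝ → E →L[ℂ] E) : SFinite (normMeasure V) := by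
  unfold normMeasure; infer_instance

theorem tendsto_normMeasure_Iio_atBot {V : ℝ → E →L[ℂ] E} (hV : ∀ a, IntegrableOn V (Iio a)) :
    Tendsto (fun x => normMeasure V (Iio x)) atBot (𝓝 0) := by
  have h := tendsto_measure_iInter_atBot (μ := normMeasure V) (s := fun x : ℝ => Iio x)
    (fun x => measurableSet_Iio.nullMeasurableSet) (fun x y h => Iio_subset_Iio h)
    ⟨0, normMeasure_Iio_ne_top hV 0⟩
  have : ⋂ x : ℝ, Iio x = ∅ := eq_empty_of_forall_notMem fun x hx =>
    lt_irrefl x (mem_iInter.1 hx x)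
  rwa [this, measure_empty] at h

/-- The integrand of a Volterra equation with a kernel of the form `K (x - r) ∘ V r`. -/
def volterraIntegrand (K : ℝ → E →L[ℂ] E) (V : ℝ → E →L[ℂ] E) (f : ℝ → E) (x r : ℝ) : E :=
  K (x - r) (V r (f r))

/-- The Volterra operator with base point `-∞`. -/
noncomputable def volterraOp (K : ℝ → E →L[ℂ] E) (V : ℝ → E →L[ℂ] E) (f : ℝ → E) (x : ℝ) : E :=
  ∫ r in Iio x, volterraIntegrand K V f x r

theorem aestronglyMeasurable_volterraIntegrand {K V : ℝ → E →L[ℂ] E} {f : ℝ → E}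
    (hK : Continuous K) (hV : ∀ a, IntegrableOn V (Iio a)) (hf : Continuous f) (x : ℝ) :
    AEStronglyMeasurable (volterraIntegrand K V f x) := by
  have happ := (isBoundedBilinearMap_apply (𝕜 := ℂ) (E := E) (F := E)).continuous
  have h1 := happ.comp_aestronglyMeasurable
    ((aestronglyMeasurable_of_integrableOn_Iio hV).prodMk hf.aestronglyMeasurable)
  have h2 : AEStronglyMeasurable (fun r => K (x - r)) volume :=
    (hK.comp (continuous_const.sub continuous_id)).aestronglyMeasurable
  exact happ.comp_aestronglyMeasurable (h2.prodMk h1)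

theorem norm_volterraIntegrand_le {K V : ℝ → E →L[ℂ] E} {f : ℝ → E} {C B x r : ℝ}
    (hK : ∀ s, 0 ≤ s → ‖K s‖ ≤ C) (hr : r ≤ x) (hB : ‖f r‖ ≤ B) :
    ‖volterraIntegrand K V f x r‖ ≤ C * (‖V r‖ * B) := by
  have hC : 0 ≤ C := (norm_nonneg _).trans (hK 0 le_rfl)
  calc ‖K (x - r) (V r (f r))‖ ≤ ‖K (x - r)‖ * ‖V r (f r)‖ := (K (x - r)).le_opNorm _
    _ ≤ C * (‖V r‖ * ‖f r‖) :=
      mul_le_mul (hK _ (sub_nonneg.2 hr)) ((V r).le_opNorm _) (norm_nonneg _) hC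
    _ ≤ C * (‖V r‖ * B) := by gcongr

theorem integrableOn_volterraIntegrand {K V : ℝ → E →L[ℂ] E} {f : ℝ → E} {C B x : ℝ}
    (hK : Continuous K) (hKC : ∀ s, 0 ≤ s → ‖K s‖ ≤ C) (hV : ∀ a, IntegrableOn V (Iio a))
    (hf : Continuous f) (hB : ∀ r < x, ‖f r‖ ≤ B) :
    IntegrableOn (volterraIntegrand K V f x) (Iio x) := by
  refine Integrable.mono' (g := fun r => C * (‖V r‖ * B))
    (((hV x).norm.mul_const B).const_mul C)
    (aestronglyMeasurable_volterraIntegrand hK hV hf x).restrict ?_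
  filter_upwards [ae_restrict_mem measurableSet_Iio] with r hr
  exact norm_volterraIntegrand_le hKC (le_of_lt hr) (hB r hr)

/-- This is the inductive step of every Neumann estimate: one application of the operator costs a
factor `C` and raises the order of the simplex by one. Extended norms make a separate integrability
check unnecessary. -/
theorem enorm_volterraOp_le {K V : ℝ → E →L[ℂ] E} {f : ℝ → E} {C : ℝ}
    (hKC : ∀ s, 0 ≤ s → ‖K s‖ ≤ C) (hV : ∀ a, IntegrableOn V (Iio a)) {B : ℝ≥0∞} (hBtop : B ≠ ∞)
    {n : ℕ} {x : ℝ} (hf : ∀ r < x, ‖f r‖ₑ ≤ B * simplexVolume (normMeasure V) n r) :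
    ‖volterraOp K V f x‖ₑ ≤
      ENNReal.ofReal C * B * simplexVolume (normMeasure V) (n + 1) x := by
  rw [simplexVolume_succ, lintegral_normMeasure hV (measurable_simplexVolume _ n),
    ← lintegral_const_mul' _ _ (ENNReal.mul_ne_top ENNReal.ofReal_ne_top hBtop)]
  refine (enorm_integral_le_lintegral_enorm _).trans (setLIntegral_mono' measurableSet_Iio ?_)
  intro r hr
  have hr' : 0 ≤ x - r := sub_nonneg.2 (le_of_lt hr)
  calc ‖K (x - r) (V r (f r))‖ₑ ≤ ‖K (x - r)‖ₑ * (‖V r‖ₑ * ‖f r‖ₑ) :=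
        ((K (x - r)).le_opENorm _).trans (mul_le_mul' le_rfl ((V r).le_opENorm _))
    _ ≤ ENNReal.ofReal C * (‖V r‖ₑ * (B * simplexVolume (normMeasure V) n r)) := by
        refine mul_le_mul' ?_ (mul_le_mul' le_rfl (hf r hr))
        rw [← ofReal_norm]
        exact ENNReal.ofReal_le_ofReal (hKC _ hr')
    _ = _ := by ring

/-- A function that is bounded at `-∞` and is a fixed point of the Volterra operator vanishes. -/
theorem eq_zero_of_volterraOp_eq {K V : ℝ → E →L[ℂ] E} {d : ℝ → E} {C : ℝ}
    (hKC : ∀ s, 0 ≤ s → ‖K s‖ ≤ C) (hV : ∀ a, IntegrableOn V (Iio a))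
    (hbdd : ∀ a, ∃ B, ∀ r ≤ a, ‖d r‖ ≤ B) (hd : ∀ x, d x = volterraOp K V d x) : d = 0 := by
  funext a
  obtain ⟨B, hB⟩ := hbdd a
  have hB0 : 0 ≤ B := (norm_nonneg _).trans (hB a le_rfl)
  have hC : 0 ≤ C := (norm_nonneg _).trans (hKC 0 le_rfl)
  -- Since `d` reproduces itself under the operator, its bound can be improved `n` times; the
  -- factorial then sends it to zero.
  have key : ∀ n : ℕ, ∀ x ≤ a, ‖d x‖ₑ ≤
      ENNReal.ofReal (B * C ^ n) * simplexVolume (normMeasure V) n x := by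
    intro n
    induction n with
    | zero =>
      intro x hx
      rw [← ofReal_norm]
      simpa [simplexVolume] using ENNReal.ofReal_le_ofReal (hB x hx)
    | succ n ih =>
      intro x hx
      rw [hd x]
      refine (enorm_volterraOp_le hKC hV ENNReal.ofReal_ne_top
        fun r hr => ih r (hr.le.trans hx)).trans_eq ?_
      rw [← ENNReal.ofReal_mul hC]
      congr 2
      ring
  have hreal : ∀ n : ℕ, ‖d a‖ ≤
      B * ((C * (normMeasure V (Iio a)).toReal) ^ n / n.factorial) := by
    intro n
    obtain ⟨h1, h2⟩ := toReal_simplexVolume_le (normMeasure V) n le_rfl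
      (normMeasure_Iio_ne_top hV a)
    have := ENNReal.toReal_mono (ENNReal.mul_ne_top ENNReal.ofReal_ne_top h1) (key n a le_rfl)
    rw [toReal_enorm, ENNReal.toReal_mul, ENNReal.toReal_ofReal (by positivity)] at this
    calc ‖d a‖ ≤ B * C ^ n * (simplexVolume (normMeasure V) n a).toReal := this
      _ ≤ B * C ^ n * ((normMeasure V (Iio a)).toReal ^ n / n.factorial) := by gcongr
      _ = _ := by rw [mul_pow]; ring
  have hlim : Tendsto (fun n : ℕ =>
      B * ((C * (normMeasure V (Iio a)).toReal) ^ n / n.factorial)) atTop (𝓝 0) := by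
    simpa using (FloorSemiring.tendsto_pow_div_factorial_atTop
      (C * (normMeasure V (Iio a)).toReal)).const_mul B
  exact norm_le_zero_iff.1 (ge_of_tendsto' hlim hreal)

/-- The image of a bounded function under the Volterra operator tends to zero at `-∞`. -/
theorem tendsto_volterraOp_atBot {K V : ℝ → E →L[ℂ] E} {f : ℝ → E} {C B a : ℝ}
    (hKC : ∀ s, 0 ≤ s → ‖K s‖ ≤ C) (hV : ∀ a, IntegrableOn V (Iio a))
    (hB : ∀ r ≤ a, ‖f r‖ ≤ B) : Tendsto (volterraOp K V f) atBot (𝓝 0) := by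
  have h0 : Tendsto (fun x => ENNReal.ofReal C * ENNReal.ofReal B * normMeasure V (Iio x))
      atBot (𝓝 0) := by
    simpa using ENNReal.Tendsto.const_mul (tendsto_normMeasure_Iio_atBot hV)
      (Or.inr (ENNReal.mul_ne_top ENNReal.ofReal_ne_top ENNReal.ofReal_ne_top))
  rw [tendsto_zero_iff_enorm_tendsto_zero]
  refine tendsto_of_tendsto_of_tendsto_of_le_of_le' tendsto_const_nhds h0
    (Eventually.of_forall fun _ => zero_le) ?_
  filter_upwards [eventually_le_atBot a] with x hx
  have := enorm_volterraOp_le (n := 0) (x := x) (f := f) hKC hV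
    (ENNReal.ofReal_ne_top (r := B)) fun r hr => by
      rw [← ofReal_norm]
      simpa [simplexVolume] using ENNReal.ofReal_le_ofReal (hB r (hr.le.trans hx))
  simpa [simplexVolume] using this

/-- Joint continuity of the Volterra operator in `x` and a parameter. -/
theorem continuousOn_volterraOp {K : ℂ → ℝ → E →L[ℂ] E} {V : ℝ → E →L[ℂ] E} {S : Set ℂ} {C : ℝ}
    {f : ℝ → ℂ → E}
    (hK : ContinuousOn (fun p : ℂ × ℝ => K p.1 p.2) (S ×ˢ univ))
    (hKC : ∀ z ∈ S, ∀ s, 0 ≤ s → ‖K z s‖ ≤ C) (hV : ∀ a, IntegrableOn V (Iio a))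
    (hf : ContinuousOn (fun p : ℝ × ℂ => f p.1 p.2) (univ ×ˢ S))
    (hbdd : ∀ a, ∃ B, ∀ r ≤ a, ∀ z ∈ S, ‖f r z‖ ≤ B) :
    ContinuousOn (fun p : ℝ × ℂ => volterraOp (K p.2) V (fun r => f r p.2) p.1)
      (univ ×ˢ S) := by
  have hKz : ∀ z ∈ S, Continuous (K z) := fun z hz =>
    hK.comp_continuous (f := fun s : ℝ => (z, s)) (by fun_prop) fun s => ⟨hz, mem_univ _⟩
  have hfz : ∀ z ∈ S, Continuous fun r => f r z := fun z hz =>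
    hf.comp_continuous (f := fun r : ℝ => (r, z)) (by fun_prop) fun s => ⟨mem_univ _, hz⟩
  rintro ⟨x₀, z₀⟩ ⟨-, hz₀⟩
  obtain ⟨B, hB⟩ := hbdd (x₀ + 1)
  -- The indicator moves the variable endpoint into the integrand, so that dominated convergence
  -- applies over a fixed domain.
  have hrw : (fun p : ℝ × ℂ => volterraOp (K p.2) V (fun r => f r p.2) p.1) =
      fun p => ∫ r, (Iio p.1).indicator (volterraIntegrand (K p.2) V (fun r => f r p.2) p.1) r := by
    funext p
    exact (integral_indicator measurableSet_Iio).symm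
  have hev : ∀ᶠ p : ℝ × ℂ in 𝓝[univ ×ˢ S] (x₀, z₀), p.2 ∈ S ∧ p.1 < x₀ + 1 := by
    refine Filter.Eventually.and ?_ ?_
    · filter_upwards [self_mem_nhdsWithin] with p hp using hp.2
    · have : Tendsto (fun p : ℝ × ℂ => p.1) (𝓝[univ ×ˢ S] (x₀, z₀)) (𝓝 x₀) :=
        (continuous_fst.tendsto (x₀, z₀)).mono_left nhdsWithin_le_nhds
      exact this.eventually (gt_mem_nhds (by linarith))
  rw [hrw]
  refine continuousWithinAt_of_dominated
    (bound := (Iio (x₀ + 1)).indicator fun r => C * (‖V r‖ * B)) ?_ ?_ ?_ ?_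
  · filter_upwards [hev] with p hp
    exact (aestronglyMeasurable_volterraIntegrand (hKz _ hp.1) hV (hfz _ hp.1) _).indicator
      measurableSet_Iio
  · filter_upwards [hev] with p hp
    refine Eventually.of_forall fun r => ?_
    by_cases hr : r < p.1
    · rw [indicator_of_mem (show r ∈ Iio p.1 from hr),
        indicator_of_mem (show r ∈ Iio (x₀ + 1) from hr.trans hp.2)]
      exact norm_volterraIntegrand_le (hKC _ hp.1) hr.le (hB r (hr.trans hp.2).le _ hp.1)
    · rw [indicator_of_notMem (show r ∉ Iio p.1 from hr), norm_zero]
      refine indicator_nonneg (fun s hs => ?_) r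
      have hC : 0 ≤ C := (norm_nonneg _).trans (hKC z₀ hz₀ 0 le_rfl)
      have hB0 : 0 ≤ B := (norm_nonneg _).trans (hB x₀ (by linarith) z₀ hz₀)
      positivity
  · exact (integrable_indicator_iff measurableSet_Iio).2
      (((hV _).norm.mul_const B).const_mul C)
  -- For `r ≠ x₀` the indicator of `Iio p.1` at `r` is constant for `p.1` near `x₀`; the one bad
  -- point is null.
  · have hne : ∀ᵐ r : ℝ, r ≠ x₀ := by simp [ae_iff, measure_singleton]
    filter_upwards [hne] with r hr
    have hfst : Tendsto (fun p : ℝ × ℂ => p.1) (𝓝[univ ×ˢ S] (x₀, z₀)) (𝓝 x₀) :=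
      (continuous_fst.tendsto (x₀, z₀)).mono_left nhdsWithin_le_nhds
    rcases lt_or_gt_of_ne hr with h | h
    · have hcont : ContinuousWithinAt (fun p : ℝ × ℂ =>
          volterraIntegrand (K p.2) V (fun r => f r p.2) p.1 r) (univ ×ˢ S) (x₀, z₀) := by
        have h1 : ContinuousOn (fun p : ℝ × ℂ => K p.2 (p.1 - r)) (univ ×ˢ S) :=
          hK.comp (f := fun p : ℝ × ℂ => (p.2, p.1 - r)) (by fun_prop)
            fun p hp => ⟨hp.2, mem_univ _⟩
        have h2 : ContinuousOn (fun p : ℝ × ℂ => f r p.2) (univ ×ˢ S) :=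
          hf.comp (f := fun p : ℝ × ℂ => (r, p.2)) (by fun_prop)
            fun p hp => ⟨mem_univ _, hp.2⟩
        exact (h1.clm_apply ((V r).continuous.comp_continuousOn h2)) _ ⟨mem_univ _, hz₀⟩
      refine hcont.congr_of_eventuallyEq ?_ (indicator_of_mem (show r ∈ Iio x₀ from h) _)
      filter_upwards [hfst.eventually (lt_mem_nhds h)] with p hp
      exact indicator_of_mem (show r ∈ Iio p.1 from hp) _
    · refine (continuousWithinAt_const (b := (0 : E))).congr_of_eventuallyEq ?_
        (indicator_of_notMem (show r ∉ Iio x₀ from h.le.not_gt) _)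
      filter_upwards [hfst.eventually (gt_mem_nhds h)] with p hp
      exact indicator_of_notMem (show r ∉ Iio p.1 from (le_of_lt hp).not_gt) _

theorem differentiableOn_volterraOp {K : ℂ → ℝ → E →L[ℂ] E} {V : ℝ → E →L[ℂ] E} {D : Set ℂ}
    {C : ℝ} {f : ℝ → ℂ → E} (hD : IsOpen D)
    (hK : ∀ z ∈ D, Continuous (K z)) (hKD : ∀ s, DifferentiableOn ℂ (fun z => K z s) D)
    (hKC : ∀ z ∈ D, ∀ s, 0 ≤ s → ‖K z s‖ ≤ C) (hV : ∀ a, IntegrableOn V (Iio a))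
    (hf : ∀ z ∈ D, Continuous fun r => f r z) (hfD : ∀ r, DifferentiableOn ℂ (f r) D)
    (hbdd : ∀ a, ∃ B, ∀ r ≤ a, ∀ z ∈ D, ‖f r z‖ ≤ B) (x : ℝ) :
    DifferentiableOn ℂ (fun z => volterraOp (K z) V (fun r => f r z) x) D := by
  obtain ⟨B, hB⟩ := hbdd x
  refine differentiableOn_integral_of_dominated (b := fun r => C * (‖V r‖ * B)) hD
    (fun z hz => (aestronglyMeasurable_volterraIntegrand (hK z hz) hV (hf z hz) x).restrict)
    (((hV x).norm.mul_const B).const_mul C) ?_ (Eventually.of_forall fun r => ?_)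
  · filter_upwards [ae_restrict_mem measurableSet_Iio] with r hr z hz
    exact norm_volterraIntegrand_le (hKC z hz) (le_of_lt hr) (hB r (le_of_lt hr) z hz)
  · exact (hKD (x - r)).clm_apply ((V r).differentiable.comp_differentiableOn (hfD r))

end Volterra

theorem exists_bound_of_continuous_of_tendsto_atBot {F : Type*} [NormedAddCommGroup F]
    {f : ℝ → F} {l : F} (hf : Continuous f)
    (hl : Tendsto f atBot (𝓝 l)) (a : ℝ) : ∃ B, ∀ r ≤ a, ‖f r‖ ≤ B := by
  obtain ⟨b, hb⟩ := eventually_atBot.1 (hl.norm.eventually (gt_mem_nhds (lt_add_one ‖l‖)))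
  obtain ⟨M, hM⟩ := (isCompact_Icc (a := b) (b := a)).exists_bound_of_continuousOn hf.continuousOn
  refine ⟨max (‖l‖ + 1) M, fun r hr => ?_⟩
  rcases le_total r b with h | h
  · exact (hb r h).le.trans (le_max_left _ _)
  · exact (hM r ⟨h, hr⟩).trans (le_max_right _ _)

/-! ### The Neumann series and its dependence on the parameter. -/

section VolterraSeries

variable {E : Type*} [NormedAddCommGroup E] [NormedSpace ℂ E]

/-- The terms of the Neumann series. -/
noncomputable def neumannTerm (K : ℂ → ℝ → E →L[ℂ] E) (V : ℝ → E →L[ℂ] E) (g : ℂ → E) :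
    ℕ → ℝ → ℂ → E
  | 0 => fun _ z => g z
  | n + 1 => fun x z => volterraOp (K z) V (fun r => neumannTerm K V g n r z) x

/-- The sum of the Neumann series. -/
noncomputable def neumannSum (K : ℂ → ℝ → E →L[ℂ] E) (V : ℝ → E →L[ℂ] E) (g : ℂ → E)
    (x : ℝ) (z : ℂ) : E :=
  ∑' n, neumannTerm K V g n x z

/-- A majorant of the Neumann series on `(-∞, a]`. -/
noncomputable def neumannBound (V : ℝ → E →L[ℂ] E) (C G a : ℝ) (n : ℕ) : ℝ :=
  G * ((C * (normMeasure V (Iio a)).toReal) ^ n / n.factorial)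

theorem summable_neumannBound (V : ℝ → E →L[ℂ] E) (C G a : ℝ) :
    Summable (neumannBound V C G a) :=
  (Real.summable_pow_div_factorial _).mul_left G

theorem norm_neumannTerm_le {K : ℂ → ℝ → E →L[ℂ] E} {V : ℝ → E →L[ℂ] E} {g : ℂ → E} {z : ℂ}
    {C G : ℝ} (hKC : ∀ s, 0 ≤ s → ‖K z s‖ ≤ C) (hV : ∀ a, IntegrableOn V (Iio a))
    (hg : ‖g z‖ ≤ G) (n : ℕ) {x a : ℝ} (hxa : x ≤ a) :
    ‖neumannTerm K V g n x z‖ ≤ neumannBound V C G a n := by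
  have hC : 0 ≤ C := (norm_nonneg _).trans (hKC 0 le_rfl)
  have hG : 0 ≤ G := (norm_nonneg _).trans hg
  have key : ∀ n : ℕ, ∀ x, ‖neumannTerm K V g n x z‖ₑ ≤
      ENNReal.ofReal (G * C ^ n) * simplexVolume (normMeasure V) n x := by
    intro n
    induction n with
    | zero =>
      intro x
      rw [← ofReal_norm]
      simpa [simplexVolume, neumannTerm] using ENNReal.ofReal_le_ofReal hg
    | succ n ih =>
      intro x
      refine (enorm_volterraOp_le hKC hV ENNReal.ofReal_ne_top fun r _ => ih r).trans_eq ?_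
      rw [← ENNReal.ofReal_mul hC]
      congr 2
      ring
  obtain ⟨h1, h2⟩ := toReal_simplexVolume_le (normMeasure V) n hxa (normMeasure_Iio_ne_top hV a)
  have := ENNReal.toReal_mono (ENNReal.mul_ne_top ENNReal.ofReal_ne_top h1) (key n x)
  rw [toReal_enorm, ENNReal.toReal_mul, ENNReal.toReal_ofReal (by positivity)] at this
  calc ‖neumannTerm K V g n x z‖
      ≤ G * C ^ n * (simplexVolume (normMeasure V) n x).toReal := this
    _ ≤ G * C ^ n * ((normMeasure V (Iio a)).toReal ^ n / n.factorial) := by gcongr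
    _ = _ := by rw [neumannBound, mul_pow]; ring

/-- Continuity of the kernel and the inhomogeneity in the parameter, with uniform bounds. -/
structure IsVolterraFamily (K : ℂ → ℝ → E →L[ℂ] E) (V : ℝ → E →L[ℂ] E) (g : ℂ → E) (S : Set ℂ)
    (C G : ℝ) : Prop where
  kernel_cont : ContinuousOn (fun p : ℂ × ℝ => K p.1 p.2) (S ×ˢ univ)
  kernel_bound : ∀ z ∈ S, ∀ s, 0 ≤ s → ‖K z s‖ ≤ C
  potential : ∀ a, IntegrableOn V (Iio a)
  inhom_cont : ContinuousOn g S
  inhom_bound : ∀ z ∈ S, ‖g z‖ ≤ G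

namespace IsVolterraFamily

variable {K : ℂ → ℝ → E →L[ℂ] E} {V : ℝ → E →L[ℂ] E} {g : ℂ → E} {S D : Set ℂ} {C G : ℝ}

theorem mono (h : IsVolterraFamily K V g S C G) (hD : D ⊆ S) : IsVolterraFamily K V g D C G where
  kernel_cont := h.kernel_cont.mono (prod_mono_left hD)
  kernel_bound z hz := h.kernel_bound z (hD hz)
  potential := h.potential
  inhom_cont := h.inhom_cont.mono hD
  inhom_bound z hz := h.inhom_bound z (hD hz)

theorem continuous_kernel (h : IsVolterraFamily K V g S C G) {z : ℂ} (hz : z ∈ S) :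
    Continuous (K z) :=
  h.kernel_cont.comp_continuous (f := fun s : ℝ => (z, s)) (by fun_prop) fun _ => ⟨hz, mem_univ _⟩

theorem norm_term_le (h : IsVolterraFamily K V g S C G) (n : ℕ) {x a : ℝ} (hxa : x ≤ a) {z : ℂ}
    (hz : z ∈ S) : ‖neumannTerm K V g n x z‖ ≤ neumannBound V C G a n :=
  norm_neumannTerm_le (h.kernel_bound z hz) h.potential (h.inhom_bound z hz) n hxa

theorem continuousOn_term (h : IsVolterraFamily K V g S C G) (n : ℕ) :
    ContinuousOn (fun p : ℝ × ℂ => neumannTerm K V g n p.1 p.2) (univ ×ˢ S) := by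
  induction n with
  | zero => exact h.inhom_cont.comp continuousOn_snd fun p hp => hp.2
  | succ n ih =>
    exact continuousOn_volterraOp h.kernel_cont h.kernel_bound h.potential ih
      fun a => ⟨neumannBound V C G a n, fun r hr z hz => h.norm_term_le n hr hz⟩

theorem continuous_term (h : IsVolterraFamily K V g S C G) (n : ℕ) {z : ℂ} (hz : z ∈ S) :
    Continuous fun x => neumannTerm K V g n x z :=
  (h.continuousOn_term n).comp_continuous (f := fun x : ℝ => (x, z)) (by fun_prop)
    fun _ => ⟨mem_univ _, hz⟩

theorem differentiableOn_term (h : IsVolterraFamily K V g D C G) (hD : IsOpen D)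
    (hKD : ∀ s, DifferentiableOn ℂ (fun z => K z s) D) (hgD : DifferentiableOn ℂ g D) (n : ℕ)
    (x : ℝ) : DifferentiableOn ℂ (neumannTerm K V g n x) D := by
  induction n generalizing x with
  | zero => exact hgD
  | succ n ih =>
    exact differentiableOn_volterraOp hD (fun z hz => h.continuous_kernel hz) hKD h.kernel_bound
      h.potential (fun z hz => h.continuous_term n hz) ih
      (fun a => ⟨neumannBound V C G a n, fun r hr z hz => h.norm_term_le n hr hz⟩) x

theorem norm_sum_le (h : IsVolterraFamily K V g S C G) {x a : ℝ} (hxa : x ≤ a) {z : ℂ}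
    (hz : z ∈ S) : ‖neumannSum K V g x z‖ ≤ ∑' n, neumannBound V C G a n :=
  tsum_of_norm_bounded (summable_neumannBound V C G a).hasSum fun n => h.norm_term_le n hxa hz

variable [CompleteSpace E]

theorem summable_term (h : IsVolterraFamily K V g S C G) (x : ℝ) {z : ℂ} (hz : z ∈ S) :
    Summable fun n => neumannTerm K V g n x z :=
  Summable.of_norm_bounded (summable_neumannBound V C G x) fun n => h.norm_term_le n le_rfl hz

theorem continuousOn_sum (h : IsVolterraFamily K V g S C G) :
    ContinuousOn (fun p : ℝ × ℂ => neumannSum K V g p.1 p.2) (univ ×ˢ S) := by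
  rintro ⟨x₀, z₀⟩ ⟨-, hz₀⟩
  have hcont : ContinuousOn (fun p : ℝ × ℂ => neumannSum K V g p.1 p.2)
      (Iio (x₀ + 1) ×ˢ S) := by
    refine continuousOn_tsum (fun n => (h.continuousOn_term n).mono
      (prod_mono_left (subset_univ _))) (summable_neumannBound V C G (x₀ + 1)) fun n p hp => ?_
    exact h.norm_term_le n (le_of_lt hp.1) hp.2
  -- The majorant is uniform only on half-lines bounded above, so continuity is obtained for `x < x₀
  -- + 1` and then localized at `x₀`.
  refine (hcont (x₀, z₀) ⟨by simp, hz₀⟩).mono_of_mem_nhdsWithin ?_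
  rw [nhdsWithin_prod_eq, nhdsWithin_univ]
  exact prod_mem_prod (Iio_mem_nhds (by linarith)) self_mem_nhdsWithin

theorem continuous_sum (h : IsVolterraFamily K V g S C G) {z : ℂ} (hz : z ∈ S) :
    Continuous fun x => neumannSum K V g x z :=
  h.continuousOn_sum.comp_continuous (f := fun x : ℝ => (x, z)) (by fun_prop)
    fun _ => ⟨mem_univ _, hz⟩

theorem differentiableOn_sum (h : IsVolterraFamily K V g D C G) (hD : IsOpen D)
    (hKD : ∀ s, DifferentiableOn ℂ (fun z => K z s) D) (hgD : DifferentiableOn ℂ g D)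
    (x : ℝ) : DifferentiableOn ℂ (neumannSum K V g x) D :=
  Complex.differentiableOn_tsum_of_summable_norm (summable_neumannBound V C G x)
    (fun n => h.differentiableOn_term hD hKD hgD n x) hD
    fun n _ hz => h.norm_term_le n le_rfl hz

/-- Dominated convergence lets the operator act term by term, which shifts the series by one index;
the missing term is `g z`. -/
theorem sum_eq (h : IsVolterraFamily K V g S C G) (x : ℝ) {z : ℂ} (hz : z ∈ S) :
    neumannSum K V g x z = g z + volterraOp (K z) V (fun r => neumannSum K V g r z) x := by
  have hint : HasSum (fun n => neumannTerm K V g (n + 1) x z)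
      (volterraOp (K z) V (fun r => neumannSum K V g r z) x) := by
    refine hasSum_integral_of_dominated_convergence
      (fun n r => C * (‖V r‖ * neumannBound V C G x n))
      (fun n => (aestronglyMeasurable_volterraIntegrand (h.continuous_kernel hz) h.potential
        (h.continuous_term n hz) x).restrict) (fun n => ?_) (Eventually.of_forall fun r => ?_) ?_
      (Eventually.of_forall fun r => ?_)
    · filter_upwards [ae_restrict_mem measurableSet_Iio] with r hr
      exact norm_volterraIntegrand_le (h.kernel_bound z hz) (le_of_lt hr)
        (h.norm_term_le n (le_of_lt hr) hz)
    · exact ((summable_neumannBound V C G x).mul_left _).mul_left _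
    · simp_rw [tsum_mul_left]
      exact ((h.potential x).norm.mul_const _).const_mul C
    · exact (((K z (x - r)).comp (V r)).hasSum (h.summable_term r hz).hasSum)
  rw [neumannSum, (h.summable_term x hz).tsum_eq_zero_add, hint.tsum_eq]
  rfl

end IsVolterraFamily

/-- A solution of `f = g + ∫_{-∞}^x K (x - r) V r (f r) dr` with limit `g` at `-∞`. -/
structure IsVolterraSolution (K : ℝ → E →L[ℂ] E) (V : ℝ → E →L[ℂ] E) (g : E) (f : ℝ → E) :
    Prop where
  cont : Continuous f
  tendsto : Tendsto f atBot (𝓝 g)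
  integrable : ∀ x, IntegrableOn (volterraIntegrand K V f x) (Iio x)
  eq : ∀ x, f x = g + volterraOp K V f x

/-- The common limit at `-∞` and continuity make the difference bounded on every half-line `(-∞,
a]`, and the difference solves the homogeneous equation. -/
theorem IsVolterraSolution.unique {K V : ℝ → E →L[ℂ] E} {g : E} {f₁ f₂ : ℝ → E} {C : ℝ}
    (hKC : ∀ s, 0 ≤ s → ‖K s‖ ≤ C) (hV : ∀ a, IntegrableOn V (Iio a))
    (h₁ : IsVolterraSolution K V g f₁) (h₂ : IsVolterraSolution K V g f₂) : f₁ = f₂ := by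
  rw [← sub_eq_zero]
  refine eq_zero_of_volterraOp_eq hKC hV (fun a => ?_) fun x => ?_
  · exact exists_bound_of_continuous_of_tendsto_atBot (h₁.cont.sub h₂.cont)
      (h₁.tendsto.sub h₂.tendsto) a
  · rw [Pi.sub_apply, h₁.eq, h₂.eq, add_sub_add_left_eq_sub, volterraOp, volterraOp, volterraOp,
      ← integral_sub (h₁.integrable x) (h₂.integrable x)]
    simp [volterraIntegrand]

theorem IsVolterraFamily.isVolterraSolution_sum [CompleteSpace E] {K : ℂ → ℝ → E →L[ℂ] E}
    {V : ℝ → E →L[ℂ] E} {g : ℂ → E} {S : Set ℂ} {C G : ℝ} (h : IsVolterraFamily K V g S C G)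
    {z : ℂ} (hz : z ∈ S) :
    IsVolterraSolution (K z) V (g z) fun x => neumannSum K V g x z where
  cont := h.continuous_sum hz
  tendsto := by
    have := tendsto_volterraOp_atBot (f := fun x => neumannSum K V g x z) (a := 0)
      (h.kernel_bound z hz) h.potential fun r hr => h.norm_sum_le hr hz
    simpa only [← h.sum_eq _ hz, add_zero] using this.const_add (g z)
  integrable x := integrableOn_volterraIntegrand (h.continuous_kernel hz) (h.kernel_bound z hz)
    h.potential (h.continuous_sum hz) fun r hr => h.norm_sum_le (le_of_lt hr) hz
  eq x := h.sum_eq x hz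

/-- The solution of a Volterra equation whose kernel is locally uniformly bounded depends
continuously on the parameter, and analytically where the kernel does. -/
theorem exists_volterraSolution_family [CompleteSpace E] {K : ℂ → ℝ → E →L[ℂ] E}
    {V : ℝ → E →L[ℂ] E} {g : ℂ → E} {S D : Set ℂ} (hD : IsOpen D) (hDS : D ⊆ S)
    (hK : ContinuousOn (fun p : ℂ × ℝ => K p.1 p.2) (S ×ˢ univ))
    (hKC : ∀ z₀ ∈ S, ∃ C, ∀ᶠ z in 𝓝[S] z₀, ∀ s, 0 ≤ s → ‖K z s‖ ≤ C)
    (hKD : ∀ s, DifferentiableOn ℂ (fun z => K z s) D)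
    (hV : ∀ a, IntegrableOn V (Iio a)) (hg : ContinuousOn g S) (hgD : DifferentiableOn ℂ g D) :
    ∃ ν : ℝ → ℂ → E,
      (∀ z ∈ S, ∀ f, IsVolterraSolution (K z) V (g z) f ↔ f = fun x => ν x z) ∧
      ∀ x, AnalyticOnNhd ℂ (ν x) D ∧ ContinuousOn (ν x) S := by
  -- Near each point of `S` a single pair of constants `C`, `G` works. All conclusions are local in
  -- `z`, and the Neumann sum itself does not depend on the choice of `U`.
  have hloc : ∀ z₀ ∈ S, ∃ U, IsOpen U ∧ z₀ ∈ U ∧ ∃ C G, IsVolterraFamily K V g (S ∩ U) C G := by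
    intro z₀ hz₀
    obtain ⟨C, hC⟩ := hKC z₀ hz₀
    have hG : ∀ᶠ z in 𝓝[S] z₀, ‖g z‖ < ‖g z₀‖ + 1 :=
      (hg z₀ hz₀).norm.eventually (gt_mem_nhds (lt_add_one _))
    obtain ⟨U, hU, hzU, hUS⟩ := mem_nhdsWithin.1 (hC.and hG)
    exact ⟨U, hU, hzU, C, ‖g z₀‖ + 1, hK.mono (prod_mono_left inter_subset_left),
      fun z hz => (hUS ⟨hz.2, hz.1⟩).1, hV, hg.mono inter_subset_left,
      fun z hz => (hUS ⟨hz.2, hz.1⟩).2.le⟩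
  refine ⟨neumannSum K V g, fun z hz f => ?_, fun x => ⟨?_, fun z hz => ?_⟩⟩
  · obtain ⟨U, -, hzU, C, G, h⟩ := hloc z hz
    have hsol := h.isVolterraSolution_sum ⟨hz, hzU⟩
    exact ⟨fun hf => hf.unique (h.kernel_bound z ⟨hz, hzU⟩) hV hsol, fun hf => hf ▸ hsol⟩
  · refine DifferentiableOn.analyticOnNhd (fun z hz => ?_) hD
    obtain ⟨U, hU, hzU, C, G, h⟩ := hloc z (hDS hz)
    have hDU : IsOpen (D ∩ U) := hD.inter hU
    exact (((h.mono (inter_subset_inter_left U hDS)).differentiableOn_sum hDU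
      (fun s => (hKD s).mono inter_subset_left) (hgD.mono inter_subset_left) x).differentiableAt
      (hDU.mem_nhds ⟨hz, hzU⟩)).differentiableWithinAt
  · obtain ⟨U, hU, hzU, C, G, h⟩ := hloc z hz
    have hc : ContinuousOn (neumannSum K V g x) (S ∩ U) :=
      h.continuousOn_sum.comp (f := fun z : ℂ => (x, z)) (by fun_prop)
        fun z hz => ⟨mem_univ _, hz⟩
    exact (hc z ⟨hz, hzU⟩).mono_of_mem_nhdsWithin
      (inter_mem self_mem_nhdsWithin (mem_nhdsWithin_of_mem_nhds (hU.mem_nhds hzU)))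

end VolterraSeries

/-! ### Exponential bounds for `cos w`, `sin w` and `sin w / w`. -/

theorem Complex.norm_exp_mul_I_le (w : ℂ) : ‖Complex.exp (w * Complex.I)‖ ≤ Real.exp |w.im| := by
  rw [Complex.norm_exp]
  simpa using neg_le_abs w.im

theorem Complex.norm_cos_le_exp (w : ℂ) : ‖Complex.cos w‖ ≤ Real.exp |w.im| := by
  have h1 := Complex.norm_exp_mul_I_le w
  have h2 := Complex.norm_exp_mul_I_le (-w)
  rw [Complex.neg_im, abs_neg] at h2
  rw [Complex.cos, norm_div, Complex.norm_ofNat, div_le_iff₀ two_pos]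
  linarith [norm_add_le (Complex.exp (w * Complex.I)) (Complex.exp (-w * Complex.I))]

theorem Complex.norm_sin_le_exp (w : ℂ) : ‖Complex.sin w‖ ≤ Real.exp |w.im| := by
  have h1 := Complex.norm_exp_mul_I_le w
  have h2 := Complex.norm_exp_mul_I_le (-w)
  rw [Complex.neg_im, abs_neg] at h2
  rw [Complex.sin, norm_div, norm_mul, Complex.norm_I, mul_one, Complex.norm_ofNat,
    div_le_iff₀ two_pos]
  linarith [norm_sub_le (Complex.exp (-w * Complex.I)) (Complex.exp (w * Complex.I))]

/-- The entire function `sin w / w`. -/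
noncomputable def Complex.sincEntire : ℂ → ℂ := dslope Complex.sin 0

theorem Complex.differentiable_sincEntire : Differentiable ℂ Complex.sincEntire := by
  rw [← differentiableOn_univ]
  exact (Complex.differentiableOn_dslope univ_mem).2 Complex.differentiable_sin.differentiableOn

theorem Complex.mul_sincEntire (w : ℂ) : w * Complex.sincEntire w = Complex.sin w := by
  simpa [sincEntire] using sub_smul_dslope Complex.sin 0 w

theorem Complex.norm_sincEntire_le_exp (w : ℂ) : ‖Complex.sincEntire w‖ ≤ Real.exp |w.im| := by
  rcases eq_or_ne w 0 with rfl | hw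
  · simp [sincEntire, dslope_same]
  -- On this strip `‖cos‖ ≤ exp |w.im|`, so the mean value inequality between `0` and `w` bounds
  -- `‖sin w‖` by `exp |w.im| * ‖w‖`; dividing by `‖w‖` finishes.
  · have hconv : Convex ℝ {v : ℂ | |v.im| ≤ |w.im|} := by
      have : {v : ℂ | |v.im| ≤ |w.im|} = Complex.imLm ⁻¹' Icc (-|w.im|) |w.im| := by
        ext v; simp [abs_le]
      rw [this]
      exact (convex_Icc _ _).linear_preimage _
    have h := hconv.norm_image_sub_le_of_norm_deriv_le (f := Complex.sin) (C := Real.exp |w.im|)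
      (x := 0) (y := w) (fun _ _ => Complex.differentiableAt_sin) (fun v hv => by
        rw [Complex.deriv_sin]
        exact (Complex.norm_cos_le_exp v).trans (Real.exp_le_exp.2 hv)) (by simp) (by simp)
    rw [Complex.sin_zero, sub_zero, sub_zero, ← Complex.mul_sincEntire, norm_mul, mul_comm] at h
    exact le_of_mul_le_mul_right h (norm_pos_iff.2 hw)

/-! ### The spectral functions and the propagator without eigenvectors. -/

namespace LPD

theorem sq_div_im (q0 : ℝ) (z : ℂ) :
    ((q0 : ℂ) ^ 2 / z).im = -(q0 ^ 2 * z.im / ‖z‖ ^ 2) := by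
  rw [Complex.sq_norm, ← Complex.ofReal_pow, div_eq_mul_inv, Complex.im_ofReal_mul,
    Complex.inv_im]
  ring

theorem kVar_im (q0 : ℝ) (z : ℂ) : (kVar q0 z).im = z.im * (1 + q0 ^ 2 / ‖z‖ ^ 2) / 2 := by
  rw [kVar, Complex.div_ofNat_im, Complex.sub_im, sq_div_im]
  ring

theorem lamVar_im (q0 : ℝ) (z : ℂ) : (lamVar q0 z).im = z.im * (1 - q0 ^ 2 / ‖z‖ ^ 2) / 2 := by
  rw [lamVar, Complex.div_ofNat_im, Complex.add_im, sq_div_im]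
  ring

/-- In this form the nonzero exceptional points are visibly the zeros of `lamVar` and of `det Y`. -/
theorem mem_excPts_iff {q0 : ℝ} {z : ℂ} : z ∈ excPts q0 ↔ z = 0 ∨ z ^ 2 + (q0 : ℂ) ^ 2 = 0 := by
  have h : z ^ 2 + (q0 : ℂ) ^ 2 = (z - Complex.I * q0) * (z - -(Complex.I * q0)) := by
    linear_combination (q0 : ℂ) ^ 2 * Complex.I_sq
  rw [h, mul_eq_zero, sub_eq_zero, sub_eq_zero]
  rfl

theorem lamVar_ne_zero {q0 : ℝ} {z : ℂ} (hz : z ∉ excPts q0) : lamVar q0 z ≠ 0 := by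
  rw [mem_excPts_iff, not_or] at hz
  intro h
  refine hz.2 ?_
  have h0 := hz.1
  rw [lamVar] at h
  field_simp at h
  simpa using h

theorem continuousOn_kVar (q0 : ℝ) : ContinuousOn (kVar q0) {0}ᶜ :=
  (continuousOn_id.sub (continuousOn_const.div continuousOn_id fun _ h => h)).div_const _

theorem continuousOn_lamVar (q0 : ℝ) : ContinuousOn (lamVar q0) {0}ᶜ :=
  (continuousOn_id.add (continuousOn_const.div continuousOn_id fun _ h => h)).div_const _

theorem differentiableOn_kVar (q0 : ℝ) : DifferentiableOn ℂ (kVar q0) {0}ᶜ :=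
  (differentiableOn_id.sub
    ((differentiableOn_const _).div differentiableOn_id fun _ h => h)).div_const _

theorem differentiableOn_lamVar (q0 : ℝ) : DifferentiableOn ℂ (lamVar q0) {0}ᶜ :=
  (differentiableOn_id.add
    ((differentiableOn_const _).div differentiableOn_id fun _ h => h)).div_const _

theorem differentiableOn_Lam (q0 : ℝ) (j : Fin 3) :
    DifferentiableOn ℂ (fun z => Lam q0 z j) {0}ᶜ := by
  fin_cases j
  · exact (differentiableOn_lamVar q0).neg
  · exact differentiableOn_kVar q0
  · exact differentiableOn_lamVar q0

theorem differentiableOn_Y_col (q0 : ℝ) (qb : Vec2) (j : Fin 3) :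
    DifferentiableOn ℂ (fun z => (Y q0 qb z).col j) {0}ᶜ := by
  rw [differentiableOn_pi]
  intro i
  fin_cases i <;> fin_cases j <;> simp only [Y, Matrix.col_apply] <;> simp <;>
    fun_prop (disch := exact fun _ h => h)

/-- Matrices acting on column vectors, as continuous linear maps. -/
noncomputable def mulVecCLM :
    Matrix (Fin 3) (Fin 3) ℂ →ₗ[ℂ] (Fin 3 → ℂ) →L[ℂ] (Fin 3 → ℂ) :=
  (LinearMap.toContinuousLinearMap (𝕜 := ℂ) (E := Fin 3 → ℂ) (F' := Fin 3 → ℂ)).toLinearMap ∘ₗ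
    (Matrix.toLin' (R := ℂ) (m := Fin 3) (n := Fin 3)).toLinearMap

theorem mulVecCLM_apply (M : Matrix (Fin 3) (Fin 3) ℂ) (v : Fin 3 → ℂ) :
    mulVecCLM M v = M.mulVec v := rfl

/-- The orthogonal projection onto the span of `(0, q^⊥)`. -/
noncomputable def perpProj (q0 : ℝ) (qb : Vec2) : Matrix (Fin 3) (Fin 3) ℂ :=
  !![0, 0, 0;
     0, qb 1 * star (qb 1) / q0 ^ 2, -(star (qb 1) * qb 0) / q0 ^ 2;
     0, -(star (qb 0) * qb 1) / q0 ^ 2, qb 0 * star (qb 0) / q0 ^ 2]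

/-- The orthogonal projection onto the complement of `(0, q^⊥)`. -/
noncomputable def parProj (q0 : ℝ) (qb : Vec2) : Matrix (Fin 3) (Fin 3) ℂ :=
  !![1, 0, 0;
     0, qb 0 * star (qb 0) / q0 ^ 2, qb 0 * star (qb 1) / q0 ^ 2;
     0, qb 1 * star (qb 0) / q0 ^ 2, qb 1 * star (qb 1) / q0 ^ 2]

/-- `-i J` times the projection `parProj`. -/
noncomputable def parJ (q0 : ℝ) (qb : Vec2) : Matrix (Fin 3) (Fin 3) ℂ :=
  (-Complex.I) • !![1, 0, 0;
     0, -(qb 0 * star (qb 0) / q0 ^ 2), -(qb 0 * star (qb 1) / q0 ^ 2);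
     0, -(qb 1 * star (qb 0) / q0 ^ 2), -(qb 1 * star (qb 1) / q0 ^ 2)]

/-- The matrix exponential `exp (s A_±)`, written without the eigenvectors. -/
noncomputable def propagator (q0 : ℝ) (qb : Vec2) (z : ℂ) (s : ℝ) : Matrix (Fin 3) (Fin 3) ℂ :=
  Complex.exp (Complex.I * s * kVar q0 z) • perpProj q0 qb +
    Complex.cos (lamVar q0 z * s) • parProj q0 qb +
    (s * Complex.sincEntire (lamVar q0 z * s)) • (kVar q0 z • parJ q0 qb + Q qb)

theorem mul_star_add_mul_star {q0 : ℝ} {qb : Vec2} (h : ‖qb‖ = q0) :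
    qb 0 * star (qb 0) + qb 1 * star (qb 1) = (q0 : ℂ) ^ 2 := by
  have hsq := EuclideanSpace.norm_sq_eq qb
  rw [h, Fin.sum_univ_two, Complex.sq_norm, Complex.sq_norm] at hsq
  rw [Complex.star_def, Complex.mul_conj, Complex.mul_conj, ← Complex.ofReal_pow, hsq]
  push_cast
  ring

/-- The columns of `Y` are eigenvectors of `A_±` with eigenvalues `i` times the entries of `Lam`.
The second is `(0, q^⊥) / q₀`; the other two lie in the complement, where `A_±` acts as `k • parJ +
Q` and squares to `-lambda²`. -/
theorem propagator_mul_Y {q0 : ℝ} (hq0 : q0 ≠ 0) {qb : Vec2} (hqb : ‖qb‖ = q0) {z : ℂ}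
    (hz : z ≠ 0) (s : ℝ) : propagator q0 qb z s * Y q0 qb z = Y q0 qb z * expLam q0 z s := by
  -- The conjugates and the transcendental factors become independent variables: `e` is the
  -- exponential, `c` the cosine, `s` the sine divided by `lambda`. The identity needs only `a * a'
  -- + b * b' = q ^ 2`.
  have alg : ∀ q a b a' b' e c s : ℂ, q ≠ 0 → a * a' + b * b' = q ^ 2 →
      (e • !![0, 0, 0;
              0, b * b' / q ^ 2, -(b' * a) / q ^ 2;
              0, -(a' * b) / q ^ 2, a * a' / q ^ 2]
        + c • !![1, 0, 0;
                 0, a * a' / q ^ 2, a * b' / q ^ 2;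
                 0, b * a' / q ^ 2, b * b' / q ^ 2]
        + s • (((z - q ^ 2 / z) / 2) • ((-Complex.I) • !![1, 0, 0;
                 0, -(a * a' / q ^ 2), -(a * b' / q ^ 2);
                 0, -(b * a' / q ^ 2), -(b * b' / q ^ 2)]) +
            !![0, a', b'; -a, 0, 0; -b, 0, 0])) *
        !![1, 0, -(Complex.I * q / z);
           -(Complex.I / z) * a, b' / q, a / q;
           -(Complex.I / z) * b, -a' / q, b / q] =
      !![1, 0, -(Complex.I * q / z);
         -(Complex.I / z) * a, b' / q, a / q;
         -(Complex.I / z) * b, -a' / q, b / q] *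
        Matrix.diagonal ![c - (z + q ^ 2 / z) / 2 * s * Complex.I, e,
          c + (z + q ^ 2 / z) / 2 * s * Complex.I] := by
    intro q a b a' b' e c s hq h
    have hI := Complex.I_sq
    ext i j
    fin_cases i <;> fin_cases j <;>
      simp [Matrix.mul_apply, Fin.sum_univ_three, Matrix.diagonal] <;> field_simp <;> grind
  have hexp : expLam q0 z s = Matrix.diagonal
      ![Complex.cos (lamVar q0 z * s) - lamVar q0 z * (s * Complex.sincEntire (lamVar q0 z * s)) *
          Complex.I, Complex.exp (Complex.I * s * kVar q0 z),
        Complex.cos (lamVar q0 z * s) + lamVar q0 z * (s * Complex.sincEntire (lamVar q0 z * s)) *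
          Complex.I] := by
    rw [← mul_assoc, Complex.mul_sincEntire, Complex.cos_add_sin_I, Complex.cos_sub_sin_I, expLam]
    congr 1
    ext l
    fin_cases l <;> simp [Lam] <;> ring_nf
  rw [hexp]
  have := alg q0 (qb 0) (qb 1) (star (qb 0)) (star (qb 1))
    (Complex.exp (Complex.I * s * kVar q0 z)) (Complex.cos (lamVar q0 z * s))
    (s * Complex.sincEntire (lamVar q0 z * s)) (by exact_mod_cast hq0) (mul_star_add_mul_star hqb)
  simpa [propagator, Y, perp, perpProj, parProj, parJ, Q, kVar, lamVar] using this

theorem isUnit_det_Y {q0 : ℝ} (hq0 : q0 ≠ 0) {qb : Vec2} (hqb : ‖qb‖ = q0) {z : ℂ}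
    (hz : z ∉ excPts q0) : IsUnit (Y q0 qb z).det := by
  have hn := mul_star_add_mul_star hqb
  rw [mem_excPts_iff, not_or] at hz
  have hz0 := hz.1
  have hq : (q0 : ℂ) ≠ 0 := by exact_mod_cast hq0
  have hI := Complex.I_sq
  have hdet : (Y q0 qb z).det = (z ^ 2 + (q0 : ℂ) ^ 2) / z ^ 2 := by
    have alg : ∀ q a b a' b' : ℂ, q ≠ 0 → a * a' + b * b' = q ^ 2 →
        (!![1, 0, -(Complex.I * q / z);
           -(Complex.I / z) * a, b' / q, a / q;
           -(Complex.I / z) * b, -a' / q, b / q]).det = (z ^ 2 + q ^ 2) / z ^ 2 := by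
      intro q a b a' b' hq h
      rw [Matrix.det_fin_three]
      simp
      field_simp
      grind
    exact alg q0 (qb 0) (qb 1) (star (qb 0)) (star (qb 1)) hq hn
  rw [isUnit_iff_ne_zero, hdet]
  exact div_ne_zero hz.2 (pow_ne_zero 2 hz0)

/-- The left side requires an invertible `Y`, while the right side stays analytic at `±i q₀`. This
replacement is what continues the equation to those points. -/
theorem Y_mul_expLam_mul_inv {q0 : ℝ} (hq0 : q0 ≠ 0) {qb : Vec2} (hqb : ‖qb‖ = q0) {z : ℂ}
    (hz : z ∉ excPts q0) (s : ℝ) :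
    Y q0 qb z * expLam q0 z s * (Y q0 qb z)⁻¹ = propagator q0 qb z s := by
  rw [← propagator_mul_Y hq0 hqb (fun h => hz (mem_excPts_iff.2 (Or.inl h))),
    Matrix.mul_nonsing_inv_cancel_right _ _ (isUnit_det_Y hq0 hqb hz)]

/-! ### The kernel and the potential of the column equations. -/

/-- The kernel of the equation for the `j`-th column. -/
noncomputable def jostKernel (q0 : ℝ) (qb : Vec2) (j : Fin 3) (z : ℂ) (s : ℝ) :
    (Fin 3 → ℂ) →L[ℂ] (Fin 3 → ℂ) :=
  Complex.exp (-(Complex.I * s * Lam q0 z j)) • mulVecCLM (propagator q0 qb z s)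

/-- The potential `ΔA_±` as a continuous real-linear function of the deviation of the field. -/
noncomputable def potentialCLM : Vec2 →L[ℝ] (Fin 3 → ℂ) →L[ℂ] (Fin 3 → ℂ) :=
  LinearMap.toContinuousLinearMap
    { toFun := fun v => mulVecCLM (Q v)
      map_add' := fun v w => by
        rw [← map_add]
        congr 1
        ext i j
        fin_cases i <;> fin_cases j <;> simp [Q] <;> ring
      map_smul' := fun c v => by
        have : Q (c • v) = (c : ℂ) • Q v := by
          ext i j
          fin_cases i <;> fin_cases j <;> simp [Q]
        rw [this, map_smul]
        rfl }

/-- The terms with `k` cancel, so the potential does not depend on `z`. -/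
theorem deltaA_eq (q0 : ℝ) (qb : Vec2) (z : ℂ) (q : Vec2) :
    mulVecCLM (deltaA q0 qb z q) = potentialCLM (q - qb) := by
  rw [deltaA, laxA, laxA, add_sub_add_left_eq_sub, map_sub, map_sub]
  rfl

theorem colIntegrand_eq {q0 : ℝ} (hq0 : q0 ≠ 0) {qb : Vec2} (hqb : ‖qb‖ = q0) (u : ℝ → Vec2)
    {z : ℂ} (hz : z ∉ excPts q0) (j : Fin 3) (x r : ℝ) (v : Fin 3 → ℂ) :
    colIntegrand q0 qb u z j x r v =
      jostKernel q0 qb j z (x - r) (potentialCLM (u r - qb) v) := by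
  rw [← deltaA_eq q0 qb z, colIntegrand, Y_mul_expLam_mul_inv hq0 hqb hz, jostKernel,
    ← Matrix.mulVec_mulVec]
  simp only [_root_.smul_apply, mulVecCLM_apply, Complex.ofReal_sub]

theorem integrableOn_Iio_comp_neg_iff {F : Type*} [NormedAddCommGroup F] (g : ℝ → F) (x : ℝ) :
    IntegrableOn (fun r => g (-r)) (Iio x) ↔ IntegrableOn g (Ioi (-x)) := by
  have h := (Measure.measurePreserving_neg (volume : Measure ℝ)).integrableOn_comp_preimage
    (Homeomorph.neg ℝ).measurableEmbedding (s := Ioi (-x)) (f := g)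
  have hpre : (Neg.neg : ℝ → ℝ) ⁻¹' Ioi (-x) = Iio x := by
    ext r; simp
  rwa [hpre] at h

theorem jostKernel_eq (q0 : ℝ) (qb : Vec2) (j : Fin 3) (z : ℂ) (s : ℝ) :
    jostKernel q0 qb j z s = Complex.exp (-(Complex.I * s * Lam q0 z j)) •
      (Complex.exp (Complex.I * s * kVar q0 z) • mulVecCLM (perpProj q0 qb) +
        Complex.cos (lamVar q0 z * s) • mulVecCLM (parProj q0 qb) +
        (s * Complex.sincEntire (lamVar q0 z * s)) •
          (kVar q0 z • mulVecCLM (parJ q0 qb) + mulVecCLM (Q qb))) := by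
  simp only [jostKernel, propagator, map_add, map_smul]

theorem continuousOn_jostKernel (q0 : ℝ) (qb : Vec2) (j : Fin 3) :
    ContinuousOn (fun p : ℂ × ℝ => jostKernel q0 qb j p.1 p.2) ({0}ᶜ ×ˢ univ) := by
  have hfst : ∀ {f : ℂ → ℂ}, ContinuousOn f {0}ᶜ →
      ContinuousOn (fun p : ℂ × ℝ => f p.1) ({0}ᶜ ×ˢ univ) := fun hf =>
    hf.comp continuousOn_fst fun p hp => hp.1
  have hk := hfst (continuousOn_kVar q0)
  have hl := hfst (continuousOn_lamVar q0)
  have hL := hfst (differentiableOn_Lam q0 j).continuousOn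
  have hs : ContinuousOn (fun p : ℂ × ℝ => (p.2 : ℂ)) ({0}ᶜ ×ˢ univ) := by fun_prop
  have hsinc := Complex.differentiable_sincEntire.continuous.comp_continuousOn (hl.mul hs)
  simp only [jostKernel_eq]
  exact (Complex.continuous_exp.comp_continuousOn ((continuousOn_const.mul hs).mul hL).neg).smul
    ((((Complex.continuous_exp.comp_continuousOn ((continuousOn_const.mul hs).mul hk)).smul
      continuousOn_const).add
    ((Complex.continuous_cos.comp_continuousOn (hl.mul hs)).smul continuousOn_const)).add
    ((hs.mul hsinc).smul ((hk.smul continuousOn_const).add continuousOn_const)))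

theorem differentiableOn_jostKernel (q0 : ℝ) (qb : Vec2) (j : Fin 3) (s : ℝ) :
    DifferentiableOn ℂ (fun z => jostKernel q0 qb j z s) {0}ᶜ := by
  have hk := differentiableOn_kVar q0
  have hl := differentiableOn_lamVar q0
  have hL := differentiableOn_Lam q0 j
  have hsinc := Complex.differentiable_sincEntire.comp_differentiableOn (hl.mul_const (s : ℂ))
  simp only [jostKernel_eq]
  exact ((hL.const_mul _).neg.cexp).smul ((((hk.const_mul _).cexp.smul_const _).add
    ((hl.mul_const _).ccos.smul_const _)).add
    ((hsinc.const_mul _).smul ((hk.smul_const _).add_const _)))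

/-! ### Locally uniform bounds on the kernel. -/

theorem norm_exp_neg_I_mul (s : ℝ) (w : ℂ) :
    ‖Complex.exp (-(Complex.I * s * w))‖ = Real.exp (s * w.im) := by
  rw [Complex.norm_exp]
  simp

/-- The condition on the spectral parameter that keeps the kernel of the `j`-th column bounded for
`σ s ≥ 0`. -/
structure IsAdmissible (q0 : ℝ) (j : Fin 3) (σ : ℝ) (z : ℂ) : Prop where
  ne_zero : z ≠ 0
  le_kVar : σ * (Lam q0 z j).im ≤ σ * (kVar q0 z).im
  add_lamVar_le : σ * (Lam q0 z j).im + |(lamVar q0 z).im| ≤ 0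
  nondegenerate : lamVar q0 z ≠ 0 ∨ σ * (Lam q0 z j).im + |(lamVar q0 z).im| < 0

/-- The projection terms have coefficients at most one by `le_kVar` and `add_lamVar_le`. The
remaining coefficient may blow up as `lambda → 0`, so its bound `b` is left as a hypothesis. -/
theorem norm_jostKernel_le {q0 : ℝ} (qb : Vec2) {j : Fin 3} {σ : ℝ} (hσ : |σ| = 1) {z : ℂ}
    (h : IsAdmissible q0 j σ z) {b : ℝ}
    (hb : ∀ s, 0 ≤ s → Real.exp (s * (σ * (Lam q0 z j).im)) *
      ‖s * Complex.sincEntire (lamVar q0 z * (σ * s : ℝ))‖ ≤ b) {s : ℝ} (hs : 0 ≤ s) :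
    ‖jostKernel q0 qb j z (σ * s)‖ ≤ ‖mulVecCLM (perpProj q0 qb)‖ + ‖mulVecCLM (parProj q0 qb)‖ +
      b * ‖kVar q0 z • mulVecCLM (parJ q0 qb) + mulVecCLM (Q qb)‖ := by
  set τ : ℝ := σ * s with hτ
  have hexp : ‖Complex.exp (-(Complex.I * τ * Lam q0 z j))‖ =
      Real.exp (s * (σ * (Lam q0 z j).im)) := by
    rw [norm_exp_neg_I_mul, hτ]
    congr 1
    ring
  have h1 : ‖Complex.exp (-(Complex.I * τ * Lam q0 z j))‖ *
      ‖Complex.exp (Complex.I * τ * kVar q0 z)‖ ≤ 1 := by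
    have : Complex.exp (Complex.I * τ * kVar q0 z) =
        Complex.exp (-(Complex.I * τ * -kVar q0 z)) := by congr 1; ring
    rw [hexp, this, norm_exp_neg_I_mul, ← Real.exp_add, Real.exp_le_one_iff, Complex.neg_im, hτ]
    nlinarith [mul_le_mul_of_nonneg_left h.le_kVar hs]
  have h2 : ‖Complex.exp (-(Complex.I * τ * Lam q0 z j))‖ *
      ‖Complex.cos (lamVar q0 z * τ)‖ ≤ 1 := by
    rw [hexp]
    refine (mul_le_mul_of_nonneg_left (Complex.norm_cos_le_exp _) (Real.exp_pos _).le).trans ?_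
    rw [← Real.exp_add, Real.exp_le_one_iff, Complex.im_mul_ofReal, abs_mul, hτ, abs_mul, hσ,
      one_mul, abs_of_nonneg hs]
    nlinarith [mul_le_mul_of_nonneg_left h.add_lamVar_le hs]
  have h3 : ‖Complex.exp (-(Complex.I * τ * Lam q0 z j))‖ *
      ‖τ * Complex.sincEntire (lamVar q0 z * τ)‖ ≤ b := by
    have : ‖(τ : ℂ) * Complex.sincEntire (lamVar q0 z * τ)‖ =
        ‖s * Complex.sincEntire (lamVar q0 z * τ)‖ := by
      rw [norm_mul, norm_mul, Complex.norm_real, Complex.norm_real, Real.norm_eq_abs,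
        Real.norm_eq_abs, hτ, abs_mul, hσ, one_mul]
    rw [hexp, this]
    exact hb s hs
  rw [jostKernel_eq, smul_add, smul_add, smul_smul, smul_smul, smul_smul]
  refine (norm_add₃_le).trans ?_
  rw [norm_smul, norm_smul, norm_smul, norm_mul, norm_mul, norm_mul]
  refine add_le_add (add_le_add ?_ ?_) ?_
  · exact mul_le_of_le_one_left (norm_nonneg _) h1
  · exact mul_le_of_le_one_left (norm_nonneg _) h2
  · exact mul_le_mul_of_nonneg_right h3 (norm_nonneg _)

/-- The oscillatory factor `exp (-i s Λ_j) sin (lambda s) / lambda` is locally uniformly bounded,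
also near the zeros of `lambda`. -/
theorem exists_bound_sinc {q0 : ℝ} {j : Fin 3} {σ : ℝ} (hσ : |σ| = 1) {S : Set ℂ}
    (hS : ∀ z ∈ S, IsAdmissible q0 j σ z) {z₀ : ℂ} (hz₀ : z₀ ∈ S) :
    ∃ b, ∀ᶠ z in 𝓝[S] z₀, ∀ s : ℝ, 0 ≤ s → Real.exp (s * (σ * (Lam q0 z j).im)) *
      ‖s * Complex.sincEntire (lamVar q0 z * (σ * s : ℝ))‖ ≤ b := by
  have hS0 : S ⊆ {0}ᶜ := fun z hz => (hS z hz).ne_zero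
  have hl : ContinuousWithinAt (lamVar q0) S z₀ := (continuousOn_lamVar q0).mono hS0 z₀ hz₀
  have hL : ContinuousWithinAt (fun z => Lam q0 z j) S z₀ :=
    (differentiableOn_Lam q0 j).continuousOn.mono hS0 z₀ hz₀
  rcases (hS z₀ hz₀).nondegenerate with h | h
  -- Here `sin (lambda s) / lambda` is bounded by dividing by `‖lambda‖`, which stays above half its
  -- value at `z₀`.
  · refine ⟨2 / ‖lamVar q0 z₀‖, ?_⟩
    have hpos : 0 < ‖lamVar q0 z₀‖ := norm_pos_iff.2 h
    filter_upwards [self_mem_nhdsWithin,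
      hl.norm.eventually (lt_mem_nhds (half_lt_self hpos))] with z hz hlz s hs
    have hlz0 : 0 < ‖lamVar q0 z‖ := (by positivity : (0 : ℝ) < ‖lamVar q0 z₀‖ / 2).trans hlz
    have hsin : ‖lamVar q0 z‖ * ‖s * Complex.sincEntire (lamVar q0 z * (σ * s : ℝ))‖ ≤
        Real.exp (s * |(lamVar q0 z).im|) := by
      have h1 := Complex.norm_sin_le_exp (lamVar q0 z * (σ * s : ℝ))
      rw [← Complex.mul_sincEntire, norm_mul, norm_mul, Complex.norm_real, Real.norm_eq_abs,
        Complex.im_mul_ofReal, abs_mul, abs_mul, abs_mul, hσ, one_mul, abs_of_nonneg hs,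
        mul_comm |(lamVar q0 z).im|] at h1
      rw [norm_mul, Complex.norm_real, Real.norm_eq_abs, ← mul_assoc]
      rwa [abs_of_nonneg hs]
    have hle : Real.exp (s * (σ * (Lam q0 z j).im)) * Real.exp (s * |(lamVar q0 z).im|) ≤ 1 := by
      rw [← Real.exp_add, Real.exp_le_one_iff, ← mul_add]
      exact mul_nonpos_of_nonneg_of_nonpos hs (hS z hz).add_lamVar_le
    have h2 : ‖lamVar q0 z‖ * (Real.exp (s * (σ * (Lam q0 z j).im)) *
        ‖s * Complex.sincEntire (lamVar q0 z * (σ * s : ℝ))‖) ≤ 1 := by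
      rw [mul_left_comm]
      exact (mul_le_mul_of_nonneg_left hsin (Real.exp_pos _).le).trans hle
    rw [le_div_iff₀ hpos]
    set A := Real.exp (s * (σ * (Lam q0 z j).im)) *
      ‖s * Complex.sincEntire (lamVar q0 z * (σ * s : ℝ))‖
    have hA : 0 ≤ A := by positivity
    nlinarith [mul_le_mul_of_nonneg_left hlz.le hA]
  · set c := -(σ * (Lam q0 z₀ j).im + |(lamVar q0 z₀).im|) with hc
    have hcpos : 0 < c := by rw [hc]; linarith
    -- No division by `lambda` is possible here. Near `z₀` the total exponential rate is below `-c /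
    -- 2`, and `y * exp (-y) ≤ 1` with `y = c * s / 2` absorbs the factor `s`.
    refine ⟨2 / c, ?_⟩
    have hcont : ContinuousWithinAt
        (fun z => -(σ * (Lam q0 z j).im + |(lamVar q0 z).im|)) S z₀ :=
      ((continuousWithinAt_const.mul (Complex.continuous_im.continuousAt.comp_continuousWithinAt
        hL)).add (Complex.continuous_im.continuousAt.comp_continuousWithinAt hl).abs).neg
    filter_upwards [hcont.eventually (lt_mem_nhds (half_lt_self hcpos))] with z hz s hs
    have hsinc := Complex.norm_sincEntire_le_exp (lamVar q0 z * (σ * s : ℝ))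
    rw [Complex.im_mul_ofReal, abs_mul, abs_mul, hσ, one_mul, abs_of_nonneg hs] at hsinc
    rw [norm_mul, Complex.norm_real, Real.norm_of_nonneg hs, le_div_iff₀ hcpos]
    have h1 : Real.exp (s * (σ * (Lam q0 z j).im)) * Real.exp (|(lamVar q0 z).im| * s) ≤
        Real.exp (-(c / 2 * s)) := by
      rw [← Real.exp_add, Real.exp_le_exp]
      nlinarith [mul_le_mul_of_nonneg_right hz.le hs]
    have h2 : c / 2 * s * Real.exp (-(c / 2 * s)) ≤ 1 := by
      rw [Real.exp_neg, ← div_eq_mul_inv, div_le_one (Real.exp_pos _)]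
      linarith [Real.add_one_le_exp (c / 2 * s)]
    calc Real.exp (s * (σ * (Lam q0 z j).im)) *
          (s * ‖Complex.sincEntire (lamVar q0 z * (σ * s : ℝ))‖) * c
        ≤ Real.exp (s * (σ * (Lam q0 z j).im)) *
          (s * Real.exp (|(lamVar q0 z).im| * s)) * c := by gcongr
      _ = s * c * (Real.exp (s * (σ * (Lam q0 z j).im)) * Real.exp (|(lamVar q0 z).im| * s)) := by
          ring
      _ ≤ s * c * Real.exp (-(c / 2 * s)) := by gcongr
      _ ≤ 2 := by linarith

theorem exists_bound_jostKernel {q0 : ℝ} (qb : Vec2) {j : Fin 3} {σ : ℝ} (hσ : |σ| = 1) {S : Set ℂ}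
    (hS : ∀ z ∈ S, IsAdmissible q0 j σ z) {z₀ : ℂ} (hz₀ : z₀ ∈ S) :
    ∃ C, ∀ᶠ z in 𝓝[S] z₀, ∀ s : ℝ, 0 ≤ s → ‖jostKernel q0 qb j z (σ * s)‖ ≤ C := by
  obtain ⟨b, hb⟩ := exists_bound_sinc hσ hS hz₀
  have hS0 : S ⊆ {0}ᶜ := fun z hz => (hS z hz).ne_zero
  set B : ℂ → (Fin 3 → ℂ) →L[ℂ] (Fin 3 → ℂ) := fun z =>
    kVar q0 z • mulVecCLM (parJ q0 qb) + mulVecCLM (Q qb) with hB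
  have hBc : ContinuousWithinAt B S z₀ :=
    (((continuousOn_kVar q0).mono hS0 z₀ hz₀).smul continuousWithinAt_const).add
      continuousWithinAt_const
  refine ⟨‖mulVecCLM (perpProj q0 qb)‖ + ‖mulVecCLM (parProj q0 qb)‖ + b * (‖B z₀‖ + 1), ?_⟩
  filter_upwards [self_mem_nhdsWithin, hb,
    hBc.norm.eventually (gt_mem_nhds (lt_add_one _))] with z hz hbz hBz s hs
  have hb0 : 0 ≤ b := le_trans (by positivity) (hbz 0 le_rfl)
  refine (norm_jostKernel_le qb hσ (hS z hz) hbz hs).trans ?_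
  gcongr

/-- One statement serves both signs: `σ = 1` is `ν_-`, and `σ = -1` is `ν_+` reflected in `x`. The
outer factor `σ` is the sign in front of the integral. -/
theorem exists_jostFamily {q0 : ℝ} (qb : Vec2) {j : Fin 3} {σ : ℝ}
    (hσ : |σ| = 1) {D S : Set ℂ} (hD : IsOpen D) (hDS : D ⊆ S)
    (hS : ∀ z ∈ S, IsAdmissible q0 j σ z) {v : ℝ → Vec2} (hv : ∀ a, IntegrableOn v (Iio a)) :
    ∃ ν : ℝ → ℂ → Fin 3 → ℂ,
      (∀ z ∈ S, ∀ f, IsVolterraSolution (fun s => (σ : ℂ) • jostKernel q0 qb j z (σ * s))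
        (fun r => potentialCLM (v r)) ((Y q0 qb z).col j) f ↔ f = fun x => ν x z) ∧
      ∀ x, AnalyticOnNhd ℂ (ν x) D ∧ ContinuousOn (ν x) S := by
  have hS0 : S ⊆ {0}ᶜ := fun z hz => (hS z hz).ne_zero
  have hYd := differentiableOn_Y_col q0 qb j
  refine exists_volterraSolution_family hD hDS
    (K := fun z s => (σ : ℂ) • jostKernel q0 qb j z (σ * s)) ?_ (fun z₀ hz₀ => ?_)
    (fun s => ((differentiableOn_jostKernel q0 qb j (σ * s)).mono (hDS.trans hS0)).const_smul
      (σ : ℂ))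
    (fun a => potentialCLM.integrable_comp (hv a)) (hYd.continuousOn.mono hS0)
    (hYd.mono (hDS.trans hS0))
  · exact ((continuousOn_jostKernel q0 qb j).comp (f := fun p : ℂ × ℝ => (p.1, σ * p.2))
      (t := {0}ᶜ ×ˢ univ) (s := S ×ˢ univ) (by fun_prop)
      fun p hp => ⟨hS0 hp.1, mem_univ _⟩).const_smul (σ : ℂ)
  · obtain ⟨C, hC⟩ := exists_bound_jostKernel qb hσ hS hz₀
    refine ⟨C, hC.mono fun z hz s hs => ?_⟩
    rw [norm_smul, Complex.norm_real, Real.norm_eq_abs, hσ, one_mul]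
    exact hz s hs

/-! ### Jost columns as solutions of Volterra equations. -/

theorem isJostColMinus_iff {q0 : ℝ} (hq0 : q0 ≠ 0) {qb : Vec2} (hqb : ‖qb‖ = q0) (u : ℝ → Vec2)
    {z : ℂ} (hz : z ∉ excPts q0) (j : Fin 3) (f : ℝ → Fin 3 → ℂ) :
    IsJostColMinus q0 qb u j z f ↔
      IsVolterraSolution (fun s => ((1 : ℝ) : ℂ) • jostKernel q0 qb j z (1 * s))
        (fun r => potentialCLM (u r - qb)) ((Y q0 qb z).col j) f := by
  have hint : ∀ x r, colIntegrand q0 qb u z j x r (f r) =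
      volterraIntegrand (fun s => ((1 : ℝ) : ℂ) • jostKernel q0 qb j z (1 * s))
        (fun r => potentialCLM (u r - qb)) f x r := fun x r => by
    rw [colIntegrand_eq hq0 hqb u hz, volterraIntegrand]
    simp
  constructor
  · rintro ⟨h1, h2, h3, h4⟩
    simp only [hint, integral_Iic_eq_integral_Iio] at h3 h4
    exact ⟨h1, h2, fun x => (h3 x).mono_set Iio_subset_Iic_self, h4⟩
  · rintro ⟨h1, h2, h3, h4⟩
    refine ⟨h1, h2, ?_, ?_⟩ <;>
      simp only [hint, integral_Iic_eq_integral_Iio]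
    · exact fun x => (integrableOn_Iic_iff_integrableOn_Iio (by finiteness)).2 (h3 x)
    · exact h4

/-- The substitution `x ↦ -x`, `r ↦ -r` moves the base point from `+∞` to `-∞` and reverses the
argument of the kernel. -/
theorem isJostColPlus_iff {q0 : ℝ} (hq0 : q0 ≠ 0) {qb : Vec2} (hqb : ‖qb‖ = q0) (u : ℝ → Vec2)
    {z : ℂ} (hz : z ∉ excPts q0) (j : Fin 3) (f : ℝ → Fin 3 → ℂ) :
    IsJostColPlus q0 qb u j z f ↔
      IsVolterraSolution (fun s => ((-1 : ℝ) : ℂ) • jostKernel q0 qb j z (-1 * s))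
        (fun r => potentialCLM (u (-r) - qb)) ((Y q0 qb z).col j) (fun x => f (-x)) := by
  set F := volterraIntegrand (fun s => ((-1 : ℝ) : ℂ) • jostKernel q0 qb j z (-1 * s))
    (fun r => potentialCLM (u (-r) - qb)) (fun x => f (-x)) with hF
  have hint : ∀ x r, F x r = -colIntegrand q0 qb u z j (-x) (-r) (f (-r)) := fun x r => by
    rw [colIntegrand_eq hq0 hqb u hz, hF, volterraIntegrand]
    rw [_root_.smul_apply, Complex.ofReal_neg, Complex.ofReal_one, neg_one_smul,
      show -1 * (x - r) = -x - -r by ring]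
  have hintegrable : ∀ x, IntegrableOn (F x) (Iio x) ↔
      IntegrableOn (fun r => colIntegrand q0 qb u z j (-x) r (f r)) (Ioi (-x)) := fun x => by
    rw [← integrableOn_Iio_comp_neg_iff, ← integrableOn_neg_iff]
    simp only [hint, Pi.neg_def, neg_neg]
  have hintegral : ∀ x, ∫ r in Iio x, F x r =
      -∫ r in Ioi (-x), colIntegrand q0 qb u z j (-x) r (f r) := fun x => by
    rw [← integral_comp_neg_Iic, integral_Iic_eq_integral_Iio, ← integral_neg]
    simp only [hint]
  constructor
  · rintro ⟨h1, h2, h3, h4⟩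
    refine ⟨h1.comp continuous_neg, h2.comp tendsto_neg_atBot_atTop,
      fun x => (hintegrable x).2 (h3 (-x)), fun x => ?_⟩
    rw [volterraOp, hintegral, ← sub_eq_add_neg]
    exact h4 (-x)
  · rintro ⟨h1, h2, h3, h4⟩
    refine ⟨by simpa [Function.comp_def] using h1.comp continuous_neg,
      by simpa [Function.comp_def] using h2.comp tendsto_neg_atTop_atBot,
      fun x => by simpa using (hintegrable (-x)).1 (h3 (-x)), fun x => ?_⟩
    have := h4 (-x)
    rw [volterraOp, hintegral, ← sub_eq_add_neg, neg_neg] at this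
    exact this

/-- The set `S` must contain `D` as well as the punctured closure, because `D` may contain an
exceptional point. There the equation with the propagator supplies the analytic extension; its
equivalence with the Jost equation is used only off `excPts`. -/
theorem extendsAnalytically_minus {q0 : ℝ} (hq0 : q0 ≠ 0) {qb : Vec2} (hqb : ‖qb‖ = q0)
    {u : ℝ → Vec2} (hu : ∀ a, IntegrableOn (fun x => u x - qb) (Iio a)) {j : Fin 3} {D S : Set ℂ}
    (hD : IsOpen D) (hDS : D ⊆ S) (hclos : closure D \ excPts q0 ⊆ S)
    (hS : ∀ z ∈ S, IsAdmissible q0 j 1 z) :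
    ExtendsAnalytically q0 (IsJostColMinus q0 qb u j) D := by
  obtain ⟨ν, h1, h2⟩ := exists_jostFamily qb (abs_one) hD hDS hS hu
  exact ⟨ν, fun z hz f => (isJostColMinus_iff hq0 hqb u hz.2 j f).trans (h1 z (hclos hz) f),
    fun x => ⟨(h2 x).1, (h2 x).2.mono hclos⟩⟩

theorem extendsAnalytically_plus {q0 : ℝ} (hq0 : q0 ≠ 0) {qb : Vec2} (hqb : ‖qb‖ = q0)
    {u : ℝ → Vec2} (hu : ∀ a, IntegrableOn (fun x => u x - qb) (Ioi a)) {j : Fin 3} {D S : Set ℂ}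
    (hD : IsOpen D) (hDS : D ⊆ S) (hclos : closure D \ excPts q0 ⊆ S)
    (hS : ∀ z ∈ S, IsAdmissible q0 j (-1) z) :
    ExtendsAnalytically q0 (IsJostColPlus q0 qb u j) D := by
  have hu' : ∀ a, IntegrableOn (fun x => u (-x) - qb) (Iio a) := fun a =>
    (integrableOn_Iio_comp_neg_iff (fun x => u x - qb) a).2 (hu (-a))
  obtain ⟨ν, h1, h2⟩ := exists_jostFamily qb (by simp) hD hDS hS hu'
  refine ⟨fun x => ν (-x), fun z hz f => ?_, fun x => ⟨(h2 (-x)).1, (h2 (-x)).2.mono hclos⟩⟩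
  rw [isJostColPlus_iff hq0 hqb u hz.2 j f, h1 z (hclos hz)]
  constructor
  · intro h
    funext x
    simpa using congrFun h (-x)
  · rintro rfl
    simp

/-! ### Admissibility of each column in its region. -/

/-- Here `σ Im lambda = |Im lambda|`, so `add_lamVar_le` is an equality and there is no decay to
spare. Nondegeneracy has to come from `lambda ≠ 0`. The condition `le_kVar` reduces to `σ Im z ≥ 0`,
since `k + lambda = z`. -/
theorem isAdmissible_zero {q0 σ : ℝ} (hq0 : 0 < q0) (hσ : |σ| = 1) {z : ℂ} (hz : z ∉ excPts q0)
    (him : 0 ≤ σ * z.im) (hnorm : q0 ≤ ‖z‖) : IsAdmissible q0 0 σ z := by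
  have hz0 : z ≠ 0 := fun h => hz (mem_excPts_iff.2 (Or.inl h))
  have hp : 0 < ‖z‖ ^ 2 := by positivity
  have hle : q0 ^ 2 / ‖z‖ ^ 2 ≤ 1 := by rw [div_le_one hp]; gcongr
  have hlam : σ * (lamVar q0 z).im = |(lamVar q0 z).im| := by
    have : 0 ≤ σ * (lamVar q0 z).im := by
      rw [lamVar_im]
      nlinarith [mul_nonneg him (sub_nonneg.2 hle)]
    rw [← abs_of_nonneg this, abs_mul, hσ, one_mul]
  refine ⟨hz0, ?_, ?_, Or.inl (lamVar_ne_zero hz)⟩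
  · simp only [Lam, Matrix.cons_val_zero, Complex.neg_im, lamVar_im, kVar_im]
    linarith
  · simp only [Lam, Matrix.cons_val_zero, Complex.neg_im]
    linarith

theorem isAdmissible_two {q0 σ : ℝ} (hσ : |σ| = 1) {z : ℂ} (hz : z ∉ excPts q0)
    (him : 0 ≤ σ * z.im) (hnorm : ‖z‖ ≤ q0) : IsAdmissible q0 2 σ z := by
  have hz0 : z ≠ 0 := fun h => hz (mem_excPts_iff.2 (Or.inl h))
  have hp : 0 < ‖z‖ ^ 2 := by positivity
  have hle : 1 ≤ q0 ^ 2 / ‖z‖ ^ 2 := by rw [one_le_div hp]; gcongr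
  have hlam : -(σ * (lamVar q0 z).im) = |(lamVar q0 z).im| := by
    have : 0 ≤ -(σ * (lamVar q0 z).im) := by
      rw [lamVar_im]
      nlinarith [mul_nonneg him (sub_nonneg.2 hle)]
    rw [← abs_of_nonneg this, abs_neg, abs_mul, hσ, one_mul]
  refine ⟨hz0, ?_, ?_, Or.inl (lamVar_ne_zero hz)⟩
  · simp only [Lam, Matrix.cons_val, lamVar_im, kVar_im]
    nlinarith [mul_nonneg him (zero_le_one.trans hle)]
  · simp only [Lam, Matrix.cons_val]
    linarith

/-- With `a = q₀² / ‖z‖²` the decay rate `σ Im k + |Im lambda|` equals `σ Im z * min 1 a`. It is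
strictly negative off the real axis, including at the zeros of `lambda`; on the real axis `lambda`
has no zeros. -/
theorem isAdmissible_one {q0 σ : ℝ} (hq0 : 0 < q0) (hσ : |σ| = 1) {z : ℂ} (hz : z ≠ 0)
    (him : σ * z.im ≤ 0) : IsAdmissible q0 1 σ z := by
  have ha : 0 < q0 ^ 2 / ‖z‖ ^ 2 := by positivity
  have hlam : |(lamVar q0 z).im| = -(σ * z.im) * |1 - q0 ^ 2 / ‖z‖ ^ 2| / 2 := by
    rw [lamVar_im, abs_div, abs_mul, abs_two, ← abs_of_nonneg (neg_nonneg.2 him), abs_neg,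
      abs_mul σ, hσ, one_mul]
  have hsum : σ * (Lam q0 z 1).im + |(lamVar q0 z).im| =
      σ * z.im * (1 + q0 ^ 2 / ‖z‖ ^ 2 - |1 - q0 ^ 2 / ‖z‖ ^ 2|) / 2 := by
    rw [hlam]
    simp only [Lam, Matrix.cons_val, kVar_im]
    ring
  have hpos : 0 < 1 + q0 ^ 2 / ‖z‖ ^ 2 - |1 - q0 ^ 2 / ‖z‖ ^ 2| := by
    rcases abs_cases (1 - q0 ^ 2 / ‖z‖ ^ 2) with h | h <;> linarith
  refine ⟨hz, le_rfl, ?_, ?_⟩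
  · rw [hsum]
    nlinarith [mul_nonneg (neg_nonneg.2 him) hpos.le]
  · rcases him.lt_or_eq with h | h
    · right
      rw [hsum]
      nlinarith [mul_pos (neg_pos.2 h) hpos]
    · left
      have hσ0 : σ ≠ 0 := by rintro rfl; simp at hσ
      have hzim : z.im = 0 := (mul_eq_zero.1 h).resolve_left hσ0
      refine lamVar_ne_zero fun hexc => ?_
      have hsq := (mem_excPts_iff.1 hexc).resolve_left hz
      have hre := congrArg Complex.re hsq
      rw [← Complex.ofReal_pow, Complex.add_re, Complex.ofReal_re, sq z, Complex.mul_re, hzim,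
        Complex.zero_re] at hre
      nlinarith [sq_nonneg z.re, sq_pos_of_pos hq0]

end LPD

theorem theorem1 (q0 : ℝ) (hq0 : 0 < q0) (qm qp : LPD.Vec2) (hqm : ‖qm‖ = q0) (hqp : ‖qp‖ = q0)
    (q : ℝ → ℝ → LPD.Vec2) (t : ℝ) :
    ((∀ a : ℝ, MeasureTheory.IntegrableOn (fun x => q x t - qm) (Set.Iio a)) →
      LPD.ExtendsAnalytically q0 (LPD.IsJostColMinus q0 qm (fun x => q x t) 0) (LPD.U1 q0) ∧
      LPD.ExtendsAnalytically q0 (LPD.IsJostColMinus q0 qm (fun x => q x t) 1)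
        {z : ℂ | z.im < 0} ∧
      LPD.ExtendsAnalytically q0 (LPD.IsJostColMinus q0 qm (fun x => q x t) 2) (LPD.U4 q0)) ∧
    ((∀ a : ℝ, MeasureTheory.IntegrableOn (fun x => q x t - qp) (Set.Ioi a)) →
      LPD.ExtendsAnalytically q0 (LPD.IsJostColPlus q0 qp (fun x => q x t) 0) (LPD.U2 q0) ∧
      LPD.ExtendsAnalytically q0 (LPD.IsJostColPlus q0 qp (fun x => q x t) 1)
        {z : ℂ | 0 < z.im} ∧
      LPD.ExtendsAnalytically q0 (LPD.IsJostColPlus q0 qp (fun x => q x t) 2) (LPD.U3 q0)) := by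
  have hq0' := hq0.ne'
  have hn1 : |(-1 : ℝ)| = 1 := by simp
  have him := Complex.continuous_im
  have hnorm := continuous_norm (E := ℂ)
  have hc := fun c : ℝ => continuous_const (X := ℂ) (y := c)
  -- The nonzero exceptional points lie on the circle `‖z‖ = q₀`, which the open regions `U1` to
  -- `U4` avoid.
  have hexc : ∀ {z : ℂ}, ‖z‖ ≠ q0 → z ≠ 0 → z ∉ LPD.excPts q0 := by
    rintro z h1 h2 (rfl | rfl | rfl)
    · exact h2 rfl
    all_goals simp [abs_of_pos hq0] at h1
  have hne : ∀ {z : ℂ}, z.im ≠ 0 → z ≠ 0 := by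
    rintro z h rfl
    exact h rfl
  refine ⟨fun hu => ⟨?_, ?_, ?_⟩, fun hu => ⟨?_, ?_, ?_⟩⟩
  · refine LPD.extendsAnalytically_minus hq0' hqm hu
      (S := {z | 0 ≤ z.im ∧ q0 ≤ ‖z‖} \ LPD.excPts q0)
      ((isOpen_lt (hc 0) him).inter (isOpen_lt (hc q0) hnorm))
      (fun z hz => ⟨⟨hz.1.le, hz.2.le⟩, hexc hz.2.ne' (hne hz.1.ne')⟩)
      (sdiff_subset_sdiff_left (closure_minimal (fun z hz => ⟨hz.1.le, hz.2.le⟩)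
        ((isClosed_le (hc 0) him).inter (isClosed_le (hc q0) hnorm))))
      fun z hz => LPD.isAdmissible_zero hq0 abs_one hz.2 (by simpa using hz.1.1) hz.1.2
  -- Only the origin is removed from `S`, so `-i q₀` remains an interior point and analyticity holds
  -- there too.
  · refine LPD.extendsAnalytically_minus hq0' hqm hu (S := {z | z.im ≤ 0} \ {0})
      (isOpen_lt him (hc 0)) (fun z (hz : z.im < 0) => ⟨hz.le, hne hz.ne⟩)
      (sdiff_subset_sdiff (closure_minimal (fun z (hz : z.im < 0) => hz.le)
        (isClosed_le him (hc 0)))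
        (by simp [LPD.excPts]))
      fun z hz => LPD.isAdmissible_one hq0 abs_one hz.2 (by simpa using hz.1)
  · refine LPD.extendsAnalytically_minus hq0' hqm hu
      (S := {z | 0 ≤ z.im ∧ ‖z‖ ≤ q0} \ LPD.excPts q0)
      ((isOpen_lt (hc 0) him).inter (isOpen_lt hnorm (hc q0)))
      (fun z hz => ⟨⟨hz.1.le, hz.2.le⟩, hexc hz.2.ne (hne hz.1.ne')⟩)
      (sdiff_subset_sdiff_left (closure_minimal (fun z hz => ⟨hz.1.le, hz.2.le⟩)
        ((isClosed_le (hc 0) him).inter (isClosed_le hnorm (hc q0)))))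
      fun z hz => LPD.isAdmissible_two abs_one hz.2 (by simpa using hz.1.1) hz.1.2
  · refine LPD.extendsAnalytically_plus hq0' hqp hu
      (S := {z | z.im ≤ 0 ∧ q0 ≤ ‖z‖} \ LPD.excPts q0)
      ((isOpen_lt him (hc 0)).inter (isOpen_lt (hc q0) hnorm))
      (fun z hz => ⟨⟨hz.1.le, hz.2.le⟩, hexc hz.2.ne' (hne hz.1.ne)⟩)
      (sdiff_subset_sdiff_left (closure_minimal (fun z hz => ⟨hz.1.le, hz.2.le⟩)
        ((isClosed_le him (hc 0)).inter (isClosed_le (hc q0) hnorm))))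
      fun z hz => LPD.isAdmissible_zero hq0 hn1 hz.2 (by simpa using hz.1.1) hz.1.2
  · refine LPD.extendsAnalytically_plus hq0' hqp hu (S := {z | 0 ≤ z.im} \ {0})
      (isOpen_lt (hc 0) him) (fun z (hz : 0 < z.im) => ⟨hz.le, hne hz.ne'⟩)
      (sdiff_subset_sdiff (closure_minimal (fun z (hz : 0 < z.im) => hz.le)
        (isClosed_le (hc 0) him))
        (by simp [LPD.excPts]))
      fun z hz => LPD.isAdmissible_one hq0 hn1 hz.2 (by simpa using hz.1)
  · refine LPD.extendsAnalytically_plus hq0' hqp hu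
      (S := {z | z.im ≤ 0 ∧ ‖z‖ ≤ q0} \ LPD.excPts q0)
      ((isOpen_lt him (hc 0)).inter (isOpen_lt hnorm (hc q0)))
      (fun z hz => ⟨⟨hz.1.le, hz.2.le⟩, hexc hz.2.ne (hne hz.1.ne)⟩)
      (sdiff_subset_sdiff_left (closure_minimal (fun z hz => ⟨hz.1.le, hz.2.le⟩)
        ((isClosed_le him (hc 0)).inter (isClosed_le hnorm (hc q0)))))
      fun z hz => LPD.isAdmissible_two hn1 hz.2 (by simpa using hz.1.1) hz.1.2
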